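/- Let $S$ be a topological monoid (a monoid with a topology making the multiplication jointly continuous). All compact spaces, topological groups and uniformities in the conditions below are Hausdorff, homomorphisms of monoids preserve the identity, and "embeds" means that there is a monoid homomorphism which is a homeomorphism onto its image. A Stone space is a compact Hausdorff space with a base of clopen sets; $w(X)$ is the weight of $X$, the least cardinality of a base of its topology; $S^{op}$ is the opposite monoid with the same topology. Then the following conditions are equivalent. 1. $S$ is l-NA (left non-archimedean): there are a Stone space $Y$ with a continuous action $S\times Y\to Y$ and a topological embedding $\nu\colon S\to Y$ with dense image such that $\nu(st)=s\,\nu(t)$ for all $s,t\in S$. 2. $S$ embeds into the monoid $C(Y,Y)$ of continuous selfmaps (under composition, with the compact-open topology) of a Stone space $Y$, where $w(Y)=w(S)$. 3. $S^{op}$ embeds into the monoid $\mathrm{End}_R(B)$ of unital ring endomorphisms (with the pointwise topology) of a discrete Boolean ring $B$ with unit, where $|B|\le \max(\aleph_0,w(S))$. 4. $S^{op}$ embeds into the monoid $D^D$ of all selfmaps (with the pointwise topology) of a discrete set $D$, where $|D|\le w(S)$. 5. $S^{op}$ embeds into the monoid $\Theta(M,d)$ of 1-Lipschitz selfmaps (with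 the pointwise topology) of an ultra-metric space $(M,d)$, where $w(M)\le w(S)$. 6. There is a uniformity on $S$, compatible with its topology, which is generated by a family of ultra-pseudometrics $\rho$ that are right nonexpansive, i.e. $\rho(xs,ys)\le\rho(x,y)$ for all $x,y,s\in S$. 7. $S$ embeds into the monoid $\mathrm{Unif}(Y,Y)$ of uniformly continuous selfmaps (with the topology of uniform convergence) of an NA uniform space $Y$, i.e. one whose uniformity has a base of equivalence relations. 8. $S$ embeds into the monoid $\mathrm{End}(K)$ of continuous endomorphisms (with the compact-open topology) of a profinite Boolean group $K$ (a profinite group in which $x^2=1$ for all $x$), where $w(K)\le \max(\aleph_0,w(S))$. 9. $S$ embeds into $\mathrm{End}(K)$ for a compact abelian group $K$, where $w(K)\le \max(\aleph_0,w(S))$. Moreover, the nine conditions obtained by dropping all the requirements on weights and cardinalities in 2, 3, 4, 5, 8 and 9 are also equivalent to each other (and to the above). For infinite $S$ satisfying any of these conditions, $w(S)$ is infinite, so that $\max(\aleph_0,w(S))=w(S)$. -/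

import Mathlib

open Topology Uniformity

universe u v

/-- The weight of a topological space: the least cardinality of a base of its topology. -/
noncomputable def weight (X : Type u) [TopologicalSpace X] : Cardinal.{u} :=
  sInf {κ | ∃ b : Set (Set X), TopologicalSpace.IsTopologicalBasis b ∧ Cardinal.mk b = κ}

/-- A Stone space: a compact Hausdorff space with a base of clopen sets. -/
structure IsStoneSpace (Y : Type u) [TopologicalSpace Y] : Prop where
  compact : CompactSpace Y
  t2 : T2Space Y
  clopen_basis : TopologicalSpace.IsTopologicalBasis {s : Set Y | IsClopen s}

/-- An action of `S` on a space `X` is non-archimedean if there is a proper `S`-compactification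
`ν : X → Y` with `Y` a Stone space: `S` acts continuously on `Y`, and `ν` is a topological
embedding, has dense range and is `S`-equivariant. -/
def IsNAAction (S : Type u) (X : Type v) [Monoid S] [TopologicalSpace S]
    [TopologicalSpace X] [MulAction S X] : Prop :=
  ∃ (Y : Type v) (_ : TopologicalSpace Y) (_ : MulAction S Y) (ν : X → Y),
    IsStoneSpace Y ∧ ContinuousSMul S Y ∧ IsEmbedding ν ∧ DenseRange ν ∧
      ∀ (s : S) (x : X), ν (s • x) = s • ν x

/-- `S` is l-NA: the left action of `S` on itself by multiplication is non-archimedean. -/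
def IsLeftNA (S : Type u) [Monoid S] [TopologicalSpace S] : Prop :=
  IsNAAction S S

/-- `S` embeds in `T` as a topological submonoid: there is an (identity preserving) monoid
homomorphism `S → T` which is a homeomorphism onto its image. -/
def TopMonoidEmbeds (S : Type u) (T : Type v) [Monoid S] [TopologicalSpace S]
    [Monoid T] [TopologicalSpace T] : Prop :=
  ∃ h : S →* T, IsEmbedding h

/-- The monoid `C(Y, Y)` of continuous selfmaps under composition, with the compact-open
topology. -/
def ContEnd (Y : Type u) [TopologicalSpace Y] : Type u := C(Y, Y)

namespace ContEnd

variable (Y : Type u) [TopologicalSpace Y]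

instance : Monoid (ContEnd Y) where
  mul f g := ContinuousMap.comp (f : C(Y, Y)) (g : C(Y, Y))
  one := ContinuousMap.id Y
  mul_assoc _ _ _ := rfl
  one_mul _ := rfl
  mul_one _ := rfl

instance : TopologicalSpace (ContEnd Y) :=
  inferInstanceAs (TopologicalSpace C(Y, Y))

end ContEnd

/-- The monoid `D ^ D` of all selfmaps of a set `D` under composition, with the topology of
pointwise convergence, `D` being discrete. -/
def SelfMap (D : Type u) : Type u := D → D

namespace SelfMap

variable (D : Type u)

instance : Monoid (SelfMap D) where
  mul f g := fun x => f (g x)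
  one := fun x => x
  mul_assoc _ _ _ := rfl
  one_mul _ := rfl
  mul_one _ := rfl

instance : TopologicalSpace (SelfMap D) :=
  @Pi.topologicalSpace D (fun _ => D) (fun _ => ⊥)

end SelfMap

/-- The monoid `End_R(B)` of (unital) ring endomorphisms of a ring `B` under composition, with
the topology of pointwise convergence, `B` being discrete. -/
def RingEndo (B : Type u) [Ring B] : Type u := B →+* B

namespace RingEndo

variable (B : Type u) [Ring B]

instance : Monoid (RingEndo B) where
  mul f g := RingHom.comp (f : B →+* B) (g : B →+* B)
  one := RingHom.id B
  mul_assoc _ _ _ := rfl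
  one_mul _ := rfl
  mul_one _ := rfl

instance : TopologicalSpace (RingEndo B) :=
  TopologicalSpace.induced (fun f : B →+* B => (f : B → B))
    (@Pi.topologicalSpace B (fun _ => B) (fun _ => ⊥))

end RingEndo

/-- The monoid `Θ(M, d)` of all 1-Lipschitz selfmaps of a metric space under composition, with
the topology of pointwise convergence. -/
def Nonexp (M : Type u) [MetricSpace M] : Type u :=
  {f : M → M // ∀ x y : M, dist (f x) (f y) ≤ dist x y}

namespace Nonexp

variable (M : Type u) [MetricSpace M]

instance : Monoid (Nonexp M) where
  mul f g := ⟨fun x => f.1 (g.1 x), fun x y => (f.2 _ _).trans (g.2 x y)⟩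
  one := ⟨fun x => x, fun _ _ => le_rfl⟩
  mul_assoc _ _ _ := rfl
  one_mul _ := rfl
  mul_one _ := rfl

instance : TopologicalSpace (Nonexp M) :=
  TopologicalSpace.induced (fun f : Nonexp M => f.1)
    (Pi.topologicalSpace : TopologicalSpace (M → M))

end Nonexp

/-- The monoid `Unif(Y, Y)` of all uniformly continuous selfmaps of a uniform space under
composition, with the topology of uniform convergence. -/
def UnifEnd (Y : Type u) [UniformSpace Y] : Type u := {f : Y → Y // UniformContinuous f}

namespace UnifEnd

variable (Y : Type u) [UniformSpace Y]

instance : Monoid (UnifEnd Y) where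
  mul f g := ⟨fun x => f.1 (g.1 x), f.2.comp g.2⟩
  one := ⟨fun x => x, uniformContinuous_id⟩
  mul_assoc _ _ _ := rfl
  one_mul _ := rfl
  mul_one _ := rfl

instance : TopologicalSpace (UnifEnd Y) :=
  TopologicalSpace.induced (fun f : UnifEnd Y => UniformFun.ofFun f.1)
    (inferInstanceAs (TopologicalSpace (UniformFun Y Y)))

end UnifEnd

/-- The monoid `End(K)` of continuous endomorphisms of a topological group under composition,
with the compact-open topology. -/
def GroupEnd (K : Type u) [Group K] [TopologicalSpace K] : Type u := K →ₜ* K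

namespace GroupEnd

variable (K : Type u) [Group K] [TopologicalSpace K]

instance : Monoid (GroupEnd K) where
  mul f g := ContinuousMonoidHom.comp (f : K →ₜ* K) (g : K →ₜ* K)
  one := ContinuousMonoidHom.id K
  mul_assoc _ _ _ := rfl
  one_mul _ := rfl
  mul_one _ := rfl

instance : TopologicalSpace (GroupEnd K) :=
  TopologicalSpace.induced (fun f : K →ₜ* K => (f : C(K, K))) ContinuousMap.compactOpen

end GroupEnd

/-- A compact (Hausdorff) topological group. -/
structure IsCompactGroup (K : Type u) [Group K] [TopologicalSpace K] : Prop where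
  topologicalGroup : IsTopologicalGroup K
  compact : CompactSpace K
  t2 : T2Space K

/-- A profinite Boolean group: a compact Hausdorff totally disconnected topological group in
which every element is its own inverse. -/
structure IsProfiniteBooleanGroup (K : Type u) [Group K] [TopologicalSpace K] : Prop where
  compactGroup : IsCompactGroup K
  totallyDisconnected : TotallyDisconnectedSpace K
  mul_self : ∀ x : K, x * x = 1

/-- The pseudometric `ρ` is an ultra-pseudometric. -/
def IsUltraPseudometric {S : Type u} (ρ : PseudoMetricSpace S) : Prop :=
  ∀ x y z : S, ρ.dist x z ≤ max (ρ.dist x y) (ρ.dist y z)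

/-- The pseudometric `ρ` on a monoid is right nonexpansive. -/
def IsRightNonexpansive {S : Type u} [Monoid S] (ρ : PseudoMetricSpace S) : Prop :=
  ∀ x y s : S, ρ.dist (x * s) (y * s) ≤ ρ.dist x y

/-- There is a (Hausdorff) uniformity on `S`, compatible with the topology, which is generated by
a family of right nonexpansive ultra-pseudometrics. -/
def HasRightNonexpansiveUltraUniformity (S : Type u) [Monoid S] [t : TopologicalSpace S] : Prop :=
  ∃ U : UniformSpace S, U.toTopologicalSpace = t ∧ @T2Space S U.toTopologicalSpace ∧
    ∃ P : Set (PseudoMetricSpace S),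
      (∀ ρ ∈ P, IsUltraPseudometric ρ ∧ IsRightNonexpansive ρ) ∧
      U = ⨅ ρ ∈ P, ρ.toUniformSpace

/-! Everything passes through one object: a right action of `S` on a discrete set `D` that is
locally constant in `s` and recovers the topology of `S` (`IsEmbeddingRightAction`).

From such an action, precomposition makes `S` act on the left on the cubes `D × D → Z`, with `Z`
finite discrete. The second factor of `D` provides a single point, the indicator of the diagonal,
whose orbit map is already an embedding (`isEmbedding_orbit_diagonal`). Its orbit closure is the
Stone compactification, and evaluation at it shows that `S` embeds in the continuous, uniformly
continuous or group endomorphisms of the cube. The 0-1 metric on `D` and the free Boolean ring on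
`D` give the remaining conditions.

Conversely, each condition yields such an action: on clopen sets by preimage, on characters by
precomposition, or on the classes of right congruences. The compact abelian case needs characters to
separate points, proved by Gelfand theory applied to the regular representation on `L²`.

Cardinal bounds enter only in `IsLeftNA.exists_selfMap`: `w(S)²` clopen sets suffice to recover the
topology of `S`, and each has an orbit of size at most `w(S)`. -/

section Weight

/-! ### Weights of topological spaces -/

theorem weight_le_mk {X : Type u} [TopologicalSpace X] {b : Set (Set X)}
    (hb : TopologicalSpace.IsTopologicalBasis b) : weight X ≤ Cardinal.mk b :=
  csInf_le' ⟨b, hb, rfl⟩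

theorem exists_basis_mk_eq_weight (X : Type u) [TopologicalSpace X] :
    ∃ b : Set (Set X), TopologicalSpace.IsTopologicalBasis b ∧ Cardinal.mk b = weight X :=
  csInf_mem (s := {κ | ∃ b : Set (Set X), TopologicalSpace.IsTopologicalBasis b ∧
    Cardinal.mk b = κ}) ⟨_, _, TopologicalSpace.isTopologicalBasis_opens, rfl⟩

theorem Topology.IsInducing.weight_le {X Y : Type u} [TopologicalSpace X] [TopologicalSpace Y]
    {f : X → Y} (hf : IsInducing f) : weight X ≤ weight Y := by
  obtain ⟨b, hb, hbw⟩ := exists_basis_mk_eq_weight Y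
  exact (weight_le_mk (hb.isInducing hf)).trans (Cardinal.mk_image_le.trans hbw.le)

theorem weight_le_mk_of_discrete (X : Type u) [TopologicalSpace X] [DiscreteTopology X] :
    weight X ≤ Cardinal.mk X := by
  refine (weight_le_mk (isTopologicalBasis_singletons X)).trans ?_
  have : {s : Set X | ∃ x, s = {x}} = Set.range (fun x : X => ({x} : Set X)) := by
    ext s; simp [eq_comm]
  rw [this]
  exact Cardinal.mk_range_le

theorem mk_le_weight_of_discrete (X : Type u) [TopologicalSpace X] [DiscreteTopology X] :
    Cardinal.mk X ≤ weight X := by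
  obtain ⟨b, hb, hbw⟩ := exists_basis_mk_eq_weight X
  rw [← hbw]
  have h : ∀ x : X, ({x} : Set X) ∈ b := fun x => by
    obtain ⟨v, hv, hxv, hvx⟩ := hb.exists_subset_of_mem_open (Set.mem_singleton x)
      (isOpen_discrete {x})
    rwa [← Set.Subset.antisymm hvx (Set.singleton_subset_iff.2 hxv)]
  exact Cardinal.mk_le_of_injective (f := fun x => (⟨{x}, h x⟩ : b))
    fun x y hxy => by simpa using hxy

/-- In a T0 space a point is determined by the members of a base that contain it. -/
theorem finite_of_weight_lt_aleph0 {X : Type u} [TopologicalSpace X] [T0Space X]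
    (h : weight X < Cardinal.aleph0) : Finite X := by
  obtain ⟨b, hb, hbw⟩ := exists_basis_mk_eq_weight X
  have hfin : Finite b := by rwa [← Cardinal.lt_aleph0_iff_finite, hbw]
  refine Finite.of_injective (fun x : X => {v : b | x ∈ v.1}) fun x y hxy => ?_
  refine hb.inseparable_iff.2 (fun v hv => ?_) |>.eq
  exact (Set.ext_iff.1 hxy ⟨v, hv⟩)

/-- A product of `E` copies of a finite discrete space has weight at most `max ℵ₀ |E|`. -/
theorem weight_pi_finite_le (E : Type u) (Z : Type) [TopologicalSpace Z] [DiscreteTopology Z]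
    [Finite Z] : weight (E → Z) ≤ max Cardinal.aleph0 (Cardinal.mk E) := by
  classical
  -- Basic sets prescribe finitely many coordinates. Inconsistent prescriptions give the empty set,
  -- which does no harm.
  let B : Finset (E × Z) → Set (E → Z) := fun p => {f | ∀ q ∈ p, f q.1 = q.2}
  have hB : TopologicalSpace.IsTopologicalBasis (Set.range B) := by
    refine TopologicalSpace.isTopologicalBasis_of_isOpen_of_nhds ?_ ?_
    · rintro _ ⟨p, rfl⟩
      have : B p = ⋂ q ∈ p, {f : E → Z | f q.1 = q.2} := by ext; simp [B]
      rw [this]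
      refine isOpen_biInter_finset fun q _ => ?_
      exact (isOpen_discrete {q.2}).preimage (continuous_apply (A := fun _ : E => Z) q.1)
    · intro f V hf hV
      obtain ⟨I, t, hI, hs⟩ := isOpen_pi_iff.1 hV f hf
      refine ⟨B (I.image fun e => (e, f e)), ⟨_, rfl⟩, by simp [B], fun g hg => hs ?_⟩
      intro e he
      have : g e = f e := hg (e, f e) (Finset.mem_image_of_mem _ he)
      rw [this]
      exact (hI e he).2
  refine (weight_le_mk hB).trans (Cardinal.mk_range_le.trans ?_)
  have hprod : Cardinal.mk (E × Z) ≤ max Cardinal.aleph0 (Cardinal.mk E) := by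
    rw [Cardinal.mk_prod]
    refine (Cardinal.mul_le_max _ _).trans ?_
    have : Cardinal.lift.{u} (Cardinal.mk Z) ≤ Cardinal.aleph0 := by
      rw [Cardinal.lift_le_aleph0]; exact (Cardinal.lt_aleph0_of_finite Z).le
    simp only [Cardinal.lift_id']
    refine max_le (max_le ?_ ?_) ?_ <;> simp_all
  rcases finite_or_infinite (E × Z) with h | h
  · exact ((Cardinal.lt_aleph0_of_finite _).le).trans (le_max_left _ _)
  · rwa [Cardinal.mk_finset_of_infinite]

end Weight

/-- A right action of a topological monoid `S` on the discrete set `D` which is continuous and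
induces the topology of `S` as the topology of pointwise convergence. -/
structure IsEmbeddingRightAction {S : Type u} {D : Type v} [Monoid S] [TopologicalSpace S]
    (a : S → D → D) : Prop where
  t0 : T0Space S
  map_one : ∀ d, a 1 d = d
  map_mul : ∀ s t d, a (s * t) d = a t (a s d)
  eventually_eq : ∀ s₀ d, ∀ᶠ s in 𝓝 s₀, a s d = a s₀ d
  exists_finite : ∀ s₀, ∀ U ∈ 𝓝 s₀, ∃ F : Set D, F.Finite ∧ ∀ s, (∀ d ∈ F, a s d = a s₀ d) → s ∈ U

/-! ### Right actions on discrete sets -/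

theorem SelfMap.nhds_hasBasis {D : Type u} (f : SelfMap D) :
    (𝓝 f).HasBasis (fun F : Set D => F.Finite) (fun F => {g | ∀ d ∈ F, g d = f d}) := by
  let : TopologicalSpace D := ⊥
  have : DiscreteTopology D := ⟨rfl⟩
  have h : 𝓝 f = Filter.pi fun d => pure (f d) := by
    simp only [← nhds_discrete D]
    exact nhds_pi (A := fun _ : D => D)
  rw [h]
  have := Filter.hasBasis_pi (fun d : D => Filter.hasBasis_pure (f d))
  refine this.to_hasBasis (fun p hp => ⟨p.1, hp.1, fun g hg => ?_⟩)
    (fun F hF => ⟨(F, fun _ => ()), ⟨hF, fun _ _ => trivial⟩, fun g hg => ?_⟩)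
  · intro d hd; exact hg d hd
  · intro d hd; exact hg d hd

theorem SelfMap.tendsto_nhds {X : Type v} {D : Type u} {l : Filter X} {F : X → SelfMap D}
    {f : SelfMap D} : Filter.Tendsto F l (𝓝 f) ↔ ∀ d, ∀ᶠ x in l, F x d = f d := by
  rw [(SelfMap.nhds_hasBasis f).tendsto_right_iff]
  refine ⟨fun h d => (h {d} (Set.finite_singleton d)).mono fun x hx => hx d rfl, fun h A hA => ?_⟩
  exact (Filter.eventually_all_finite hA).2 fun d _ => h d

instance SelfMap.t2Space (D : Type u) : T2Space (SelfMap D) := by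
  let : TopologicalSpace D := ⊥
  have : DiscreteTopology D := ⟨rfl⟩
  exact inferInstanceAs (T2Space (D → D))

/-- The homomorphism `Sᵐᵒᵖ → D ^ D` corresponding to a right action. -/
def IsEmbeddingRightAction.hom {S : Type u} {D : Type v} [Monoid S]
    [TopologicalSpace S] {a : S → D → D} (ha : IsEmbeddingRightAction a) : Sᵐᵒᵖ →* SelfMap D where
  toFun s := a s.unop
  map_one' := funext ha.map_one
  map_mul' s t := funext fun d => ha.map_mul t.unop s.unop d

theorem IsEmbeddingRightAction.isEmbedding {S : Type u} {D : Type v} [Monoid S]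
    [TopologicalSpace S] {a : S → D → D} (ha : IsEmbeddingRightAction a) :
    IsEmbedding (fun s : S => (show SelfMap D from a s)) := by
  have := ha.t0
  refine IsInducing.isEmbedding (isInducing_iff_nhds.2 fun s₀ => le_antisymm ?_ ?_)
  · exact Filter.map_le_iff_le_comap.1 (SelfMap.tendsto_nhds.2 (ha.eventually_eq s₀))
  · intro U hU
    obtain ⟨F, hF, hFU⟩ := ha.exists_finite s₀ U hU
    exact ⟨_, (SelfMap.nhds_hasBasis _).mem_of_mem hF, fun s hs => hFU s hs⟩

theorem IsEmbeddingRightAction.isEmbedding_hom {S : Type u} {D : Type v} [Monoid S]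
    [TopologicalSpace S] {a : S → D → D} (ha : IsEmbeddingRightAction a) : IsEmbedding ha.hom :=
  ha.isEmbedding.comp MulOpposite.opHomeomorph.symm.isEmbedding

theorem IsEmbeddingRightAction.topMonoidEmbeds {S : Type u} {D : Type v} [Monoid S]
    [TopologicalSpace S] {a : S → D → D} (ha : IsEmbeddingRightAction a) :
    TopMonoidEmbeds Sᵐᵒᵖ (SelfMap D) :=
  ⟨ha.hom, ha.isEmbedding_hom⟩

theorem exists_isEmbeddingRightAction {S : Type u} {D : Type v} [Monoid S]
    [TopologicalSpace S] (h : TopMonoidEmbeds Sᵐᵒᵖ (SelfMap D)) :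
    ∃ a : S → D → D, IsEmbeddingRightAction a := by
  obtain ⟨h, hh⟩ := h
  have hemb : IsEmbedding fun s : S => h (MulOpposite.op s) :=
    hh.comp MulOpposite.opHomeomorph.isEmbedding
  refine ⟨fun s => h (MulOpposite.op s), ?_, fun d => ?_, fun s t d => ?_, fun s₀ d => ?_,
    fun s₀ U hU => ?_⟩
  · have := hemb.t2Space
    infer_instance
  · rw [MulOpposite.op_one, map_one]; rfl
  · rw [MulOpposite.op_mul, map_mul]; rfl
  · exact SelfMap.tendsto_nhds.1 (hemb.continuous.tendsto s₀) d
  · rw [hemb.isInducing.nhds_eq_comap] at hU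
    obtain ⟨F, hF, hFU⟩ := ((SelfMap.nhds_hasBasis _).comap _).mem_iff.1 hU
    exact ⟨F, hF, fun s hs => hFU hs⟩

namespace IsEmbeddingRightAction

variable {S : Type u} {D : Type v} [Monoid S] [TopologicalSpace S] {a : S → D → D}

/-- The diagonal right action on `D × D` through the second factor. -/
theorem prod (ha : IsEmbeddingRightAction a) :
    IsEmbeddingRightAction fun (s : S) (p : D × D) => (p.1, a s p.2) where
  t0 := ha.t0
  map_one p := by simp [ha.map_one]
  map_mul s t p := by simp [ha.map_mul]
  eventually_eq s₀ p := (ha.eventually_eq s₀ p.2).mono fun s hs => by simp [hs]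
  exists_finite s₀ U hU := by
    obtain ⟨F, hF, hFU⟩ := ha.exists_finite s₀ U hU
    refine ⟨(fun d => (d, d)) '' F, hF.image _, fun s hs => hFU s fun d hd => ?_⟩
    simpa using hs (d, d) ⟨d, hd, rfl⟩

variable {Z : Type} [TopologicalSpace Z] [DiscreteTopology Z]

/-- Near `(s₀, y₀)` the coordinate `d` of the image reads only the coordinate `a s₀ d` of `y`,
because `s ↦ a s d` is locally constant. -/
theorem continuous_comp (ha : IsEmbeddingRightAction a) :
    Continuous fun p : S × (D → Z) => fun d => p.2 (a p.1 d) := by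
  refine continuous_pi fun d => continuous_discrete_rng.2 fun z => ?_
  refine isOpen_iff_mem_nhds.2 fun p hp => ?_
  have h1 := (continuous_fst.tendsto p).eventually (ha.eventually_eq p.1 d)
  have h2 : ∀ᶠ q : S × (D → Z) in 𝓝 p, q.2 (a p.1 d) = p.2 (a p.1 d) := by
    have : Continuous fun q : S × (D → Z) => q.2 (a p.1 d) :=
      (continuous_apply (A := fun _ : D => Z) _).comp continuous_snd
    exact ((isOpen_discrete {p.2 (a p.1 d)}).preimage this).mem_nhds rfl
  filter_upwards [h1, h2] with q hq1 hq2
  simp only [Set.mem_preimage, Set.mem_singleton_iff] at hp ⊢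
  rw [hq1, hq2, hp]

theorem continuous_orbit (ha : IsEmbeddingRightAction a) (y : D → Z) :
    Continuous fun s : S => fun d => y (a s d) :=
  ha.continuous_comp.comp (Continuous.prodMk_left y)

open Classical in
/-- The orbit map of the indicator function of the diagonal is an embedding. -/
theorem isEmbedding_orbit_diagonal (ha : IsEmbeddingRightAction a) {z w : Z} (hzw : z ≠ w) :
    IsEmbedding fun (s : S) (p : D × D) => if p.1 = a s p.2 then z else w := by
  have := ha.t0
  have hc := ha.prod.continuous_orbit (fun p : D × D => if p.1 = p.2 then z else w)
  refine IsInducing.isEmbedding (isInducing_iff_nhds.2 fun s₀ => le_antisymm ?_ ?_)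
  · exact Filter.map_le_iff_le_comap.1 (hc.tendsto s₀)
  · intro U hU
    obtain ⟨F, hF, hFU⟩ := ha.exists_finite s₀ U hU
    -- At the coordinate `(a s₀ d, d)` the orbit of `s` takes the value `z` exactly when `a s d = a
    -- s₀ d`.
    refine ⟨{f | ∀ d ∈ F, f (a s₀ d, d) = z}, ?_, fun s hs => hFU s fun d hd => ?_⟩
    · refine (Filter.eventually_all_finite hF).2 fun d _ => ?_
      exact ((isOpen_discrete {z}).preimage
        (continuous_apply (A := fun _ : D × D => Z) (a s₀ d, d))).mem_nhds (by simp)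
    · by_contra hne
      have : (if a s₀ d = a s d then z else w) = z := hs d hd
      rw [if_neg (Ne.symm hne)] at this
      exact hzw this.symm

end IsEmbeddingRightAction

/-- An element of `ContEnd Y` as a continuous map. -/
def ContEnd.toContinuousMap {Y : Type u} [TopologicalSpace Y] (f : ContEnd Y) : C(Y, Y) := f

/-- An element of `GroupEnd K` as a continuous homomorphism. -/
def GroupEnd.toHom {K : Type u} [Group K] [TopologicalSpace K] (f : GroupEnd K) : K →ₜ* K := f

/-- An element of `RingEndo B` as a selfmap of `B`. -/
def RingEndo.toSelfMap {B : Type u} [Ring B] (f : RingEndo B) : SelfMap B :=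
  fun x => DFunLike.coe (F := B →+* B) f x

theorem IsStoneSpace.of_totallyDisconnected (Y : Type u) [TopologicalSpace Y] [CompactSpace Y]
    [T2Space Y] [TotallyDisconnectedSpace Y] : IsStoneSpace Y :=
  ⟨inferInstance, inferInstance, isTopologicalBasis_isClopen⟩

/-! ### Actions on the cubes `D × D → Z` -/

section Cube

variable {S D : Type u} [Monoid S] [TopologicalSpace S] {a : S → D → D}

/-- The compactification is the closure of the orbit of the diagonal's indicator, an invariant
closed subset of the cube. -/
theorem IsEmbeddingRightAction.isLeftNA (ha : IsEmbeddingRightAction a) : IsLeftNA S := by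
  classical
  let E := D × D
  let b : S → E → E := fun s p => (p.1, a s p.2)
  have hb : IsEmbeddingRightAction b := ha.prod
  let _ : MulAction S (E → Bool) :=
    { smul := fun s y e => y (b s e)
      one_smul := fun y => funext fun e => congrArg y (hb.map_one e)
      mul_smul := fun s t y => funext fun e => congrArg y (hb.map_mul s t e) }
  have : ContinuousSMul S (E → Bool) := ⟨hb.continuous_comp⟩
  let o : S → E → Bool := fun s p => if p.1 = a s p.2 then true else false
  have ho : IsEmbedding o := ha.isEmbedding_orbit_diagonal (by decide)
  have hso : ∀ s t, o (s * t) = s • o t := fun s t => funext fun p => by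
    change (if p.1 = a (s * t) p.2 then true else false) = if p.1 = a t (a s p.2) then true else false
    rw [ha.map_mul]
  let C : Set (E → Bool) := closure (Set.range o)
  have hC : ∀ (s : S), ∀ y ∈ C, s • y ∈ C := fun s y hy =>
    map_mem_closure (continuous_const_smul s) hy (by
      rintro _ ⟨t, rfl⟩; exact ⟨s * t, hso s t⟩)
  have hCc : CompactSpace C := isCompact_iff_compactSpace.1 isClosed_closure.isCompact
  let _ : MulAction S C :=
    { smul := fun s y => ⟨s • y.1, hC s y y.2⟩
      one_smul := fun y => Subtype.ext (one_smul S y.1)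
      mul_smul := fun s t y => Subtype.ext (mul_smul s t y.1) }
  refine ⟨C, inferInstance, inferInstance, fun s => ⟨o s, subset_closure ⟨s, rfl⟩⟩,
    .of_totallyDisconnected C, ⟨?_⟩, ?_, ?_, fun s t => Subtype.ext (hso s t)⟩
  · exact Continuous.subtype_mk
      (continuous_fst.smul (continuous_subtype_val.comp continuous_snd)) _
  · exact IsEmbedding.of_comp (ho.continuous.subtype_mk _) continuous_subtype_val ho
  · rintro ⟨y, hy⟩
    rw [closure_subtype]
    convert hy
    ext z
    simp only [Set.mem_image, Set.mem_range, Subtype.exists]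
    constructor
    · rintro ⟨_, _, ⟨s, hs⟩, rfl⟩
      exact ⟨s, congrArg Subtype.val hs⟩
    · rintro ⟨s, rfl⟩
      exact ⟨_, subset_closure ⟨s, rfl⟩, ⟨s, rfl⟩, rfl⟩

/-- This lower bound turns the weight estimate for the cube into an equality. -/
theorem IsEmbeddingRightAction.weight_le_cube (ha : IsEmbeddingRightAction a) :
    weight S ≤ weight (D × D → Bool) :=
  (ha.isEmbedding_orbit_diagonal (z := true) (w := false) (by decide)).isInducing.weight_le

theorem weight_square_cube_le (D : Type u) (Z : Type) [TopologicalSpace Z] [DiscreteTopology Z]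
    [Finite Z] : weight (D × D → Z) ≤ max Cardinal.aleph0 (Cardinal.mk D) := by
  refine (weight_pi_finite_le (D × D) Z).trans (max_le (le_max_left _ _) ?_)
  rw [Cardinal.mk_prod, Cardinal.lift_id]
  exact (Cardinal.mul_le_max _ _).trans (by simp [le_total])

/-- Joint continuity gives continuity into the compact-open topology by currying. Evaluation at the
diagonal's indicator is continuous and turns the map into the orbit embedding, so the map itself is
an embedding. -/
theorem IsEmbeddingRightAction.embeds_contEnd_cube (ha : IsEmbeddingRightAction a) :
    TopMonoidEmbeds S (ContEnd (D × D → Bool)) := by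
  classical
  have hc := ha.prod.continuous_comp (Z := Bool)
  let h : S →* ContEnd (D × D → Bool) :=
    { toFun := fun s => (⟨fun y p => y (p.1, a s p.2), hc.comp (Continuous.prodMk_right s)⟩ :
        C(D × D → Bool, D × D → Bool))
      map_one' := ContinuousMap.ext fun y => funext fun p => by
        change y (p.1, a 1 p.2) = y p
        rw [ha.map_one]
      map_mul' := fun s t => ContinuousMap.ext fun y => funext fun p => by
        change y (p.1, a (s * t) p.2) = y (p.1, a t (a s p.2))
        rw [ha.map_mul] }
  refine ⟨h, IsEmbedding.of_comp (g := fun f : C(D × D → Bool, D × D → Bool) =>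
    f fun p => if p.1 = p.2 then true else false) ?_ ?_
    (ha.isEmbedding_orbit_diagonal (z := true) (w := false) (by decide))⟩
  · exact ContinuousMap.continuous_of_continuous_uncurry
      (fun s => (h s).toContinuousMap) hc
  · exact continuous_eval_const _

/-- On a compact space the compact-open topology is that of uniform convergence. -/
theorem IsEmbeddingRightAction.embeds_unifEnd_cube (ha : IsEmbeddingRightAction a) :
    TopMonoidEmbeds S (UnifEnd (D × D → Bool)) := by
  obtain ⟨h, hh⟩ := ha.embeds_contEnd_cube
  let h' : S →* UnifEnd (D × D → Bool) :=
    { toFun := fun s => ⟨(h s).toContinuousMap,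
        CompactSpace.uniformContinuous_of_continuous (h s).toContinuousMap.continuous⟩
      map_one' := Subtype.ext (congrArg (fun f => ⇑(ContEnd.toContinuousMap f)) (MonoidHom.map_one h))
      map_mul' := fun s t =>
        Subtype.ext (congrArg (fun f => ⇑(ContEnd.toContinuousMap f)) (MonoidHom.map_mul h s t)) }
  refine ⟨h', ?_⟩
  have hg : IsEmbedding (fun f : UnifEnd (D × D → Bool) => UniformFun.ofFun f.1) :=
    ⟨⟨rfl⟩, fun f g hfg => Subtype.ext hfg⟩
  refine (hg.of_comp_iff (f := h')).1 ?_
  exact (ContinuousMap.isUniformEmbedding_uniformFunOfFun (α := D × D → Bool)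
    (β := D × D → Bool)).isEmbedding.comp hh

theorem IsEmbeddingRightAction.embeds_groupEnd_cube (ha : IsEmbeddingRightAction a) :
    TopMonoidEmbeds S (GroupEnd (D × D → Multiplicative (ZMod 2))) := by
  classical
  let K := D × D → Multiplicative (ZMod 2)
  have hc := ha.prod.continuous_comp (Z := Multiplicative (ZMod 2))
  let h : S →* GroupEnd K :=
    { toFun := fun s => (⟨⟨⟨fun y p => y (p.1, a s p.2), rfl⟩, fun _ _ => rfl⟩,
        hc.comp (Continuous.prodMk_right s)⟩ : K →ₜ* K)
      map_one' := ContinuousMonoidHom.ext fun y => funext fun p => by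
        change y (p.1, a 1 p.2) = y p
        rw [ha.map_one]
      map_mul' := fun s t => ContinuousMonoidHom.ext fun y => funext fun p => by
        change y (p.1, a (s * t) p.2) = y (p.1, a t (a s p.2))
        rw [ha.map_mul] }
  refine ⟨h, IsEmbedding.of_comp (g := fun f : GroupEnd K =>
    f.toHom fun p => if p.1 = p.2 then Multiplicative.ofAdd 1 else 1) ?_ ?_
    (ha.isEmbedding_orbit_diagonal (z := Multiplicative.ofAdd (1 : ZMod 2)) (w := 1)
      (by decide))⟩
  · exact continuous_induced_rng.2 (ContinuousMap.continuous_of_continuous_uncurry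
      (fun s => ((h s).toHom : C(K, K))) hc)
  · exact (continuous_eval_const (F := C(K, K)) _).comp
      (continuous_induced_dom (f := fun f : GroupEnd K => (f.toHom : C(K, K))))

theorem isProfiniteBooleanGroup_cube (E : Type u) :
    IsProfiniteBooleanGroup (E → Multiplicative (ZMod 2)) where
  compactGroup := ⟨inferInstance, inferInstance, inferInstance⟩
  totallyDisconnected := inferInstance
  mul_self x := funext fun e => by
    have : ∀ z : Multiplicative (ZMod 2), z * z = 1 := by decide
    exact this (x e)

end Cube

/-! ### The 0-1 metric -/

section DiscreteMetric

open Classical in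
/-- The metric on `D` with all distances between distinct points equal to `1`. -/
noncomputable abbrev discreteMetricSpace (D : Type u) : MetricSpace D where
  dist x y := if x = y then 0 else 1
  dist_self x := by simp
  dist_comm x y := by simp [eq_comm]
  dist_triangle x y z := by split_ifs <;> simp_all
  eq_of_dist_eq_zero {x y} h := by by_contra hne; simp [hne] at h
  -- The uniformity is given explicitly so that the topology is definitionally the discrete one used
  -- in `SelfMap`.
  toUniformSpace := ⊥
  uniformity_dist := by
    rw [bot_uniformity]
    refine le_antisymm ?_ (Filter.le_principal_iff.2 ?_)
    · refine le_iInf₂ fun ε hε => Filter.principal_mono.2 ?_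
      rintro ⟨x, y⟩ (rfl : x = y)
      simpa using hε
    · refine Filter.mem_iInf_of_mem 1 (Filter.mem_iInf_of_mem one_pos ?_)
      rw [Filter.mem_principal]
      rintro ⟨x, y⟩ h
      by_contra hne
      have hne' : ¬ x = y := hne
      simp [hne'] at h

open Classical in
theorem dist_discreteMetricSpace {D : Type u} (x y : D) :
    (discreteMetricSpace D).dist x y = if x = y then 0 else 1 := rfl

theorem isUltrametricDist_discreteMetricSpace (D : Type u) :
    @IsUltrametricDist D (discreteMetricSpace D).toDist :=
  let _ := discreteMetricSpace D
  ⟨fun x y z => by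
    simp only [dist_discreteMetricSpace]
    split_ifs <;> simp_all⟩

variable {S : Type v} {D : Type u} [Monoid S] [TopologicalSpace S] {a : S → D → D}

/-- Every selfmap is 1-Lipschitz for the 0-1 metric. -/
theorem IsEmbeddingRightAction.embeds_nonexp (ha : IsEmbeddingRightAction a) :
    TopMonoidEmbeds Sᵐᵒᵖ (@Nonexp D (discreteMetricSpace D)) := by
  let _ := discreteMetricSpace D
  let h : Sᵐᵒᵖ →* Nonexp D :=
    { toFun := fun s => ⟨ha.hom s, fun x y => by
        simp only [dist_discreteMetricSpace]
        split_ifs <;> simp_all⟩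
      map_one' := Subtype.ext (MonoidHom.map_one ha.hom)
      map_mul' := fun s t => Subtype.ext (MonoidHom.map_mul ha.hom s t) }
  have hg : IsEmbedding (fun f : Nonexp D => (f.1 : SelfMap D)) :=
    ⟨⟨rfl⟩, Subtype.val_injective⟩
  exact ⟨h, (hg.of_comp_iff (f := h)).1 ha.isEmbedding_hom⟩

theorem weight_discreteMetricSpace_le (D : Type u) :
    @weight D (discreteMetricSpace D).toUniformSpace.toTopologicalSpace ≤ Cardinal.mk D := by
  let _ := discreteMetricSpace D
  have : DiscreteTopology D := ⟨rfl⟩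
  exact weight_le_mk_of_discrete D

/-- Each `d` contributes the pullback of the 0-1 metric along `s ↦ a s d`. Right multiplication by
`s` applies `a s` to both points, which cannot separate equal ones. -/
theorem IsEmbeddingRightAction.hasRightNonexpansiveUltraUniformity
    (ha : IsEmbeddingRightAction a) : HasRightNonexpansiveUltraUniformity S := by
  let ρ : D → PseudoMetricSpace S := fun d =>
    PseudoMetricSpace.induced (fun s => a s d) (discreteMetricSpace D).toPseudoMetricSpace
  have htop : (⨅ r ∈ Set.range ρ, r.toUniformSpace).toTopologicalSpace = ‹TopologicalSpace S› := by
    rw [iInf_range, UniformSpace.toTopologicalSpace_iInf, ha.isEmbedding.eq_induced]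
    symm
    refine induced_iInf.trans (iInf_congr fun d => ?_)
    exact induced_compose
  refine ⟨⨅ r ∈ Set.range ρ, r.toUniformSpace, htop, ?_, Set.range ρ, ?_, rfl⟩
  · rw [htop]
    exact ha.isEmbedding.t2Space
  · rintro _ ⟨d, rfl⟩
    refine ⟨fun x y z => ?_, fun x y s => ?_⟩
    · exact (isUltrametricDist_discreteMetricSpace D).dist_triangle_max _ _ _
    · change (discreteMetricSpace D).dist (a (x * s) d) (a (y * s) d) ≤
        (discreteMetricSpace D).dist (a x d) (a y d)
      simp only [dist_discreteMetricSpace, ha.map_mul]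
      split_ifs <;> simp_all

end DiscreteMetric

/-! ### Free Boolean rings -/

section FreeBooleanRing

/-- The free Boolean ring on a set `D`. -/
abbrev FreeBooleanRing (D : Type u) : Type u :=
  MvPolynomial D (ZMod 2) ⧸ Ideal.span (Set.range fun d : D =>
    (MvPolynomial.X d ^ 2 - MvPolynomial.X d : MvPolynomial D (ZMod 2)))

namespace FreeBooleanRing

variable {D : Type u}

/-- The generator of the free Boolean ring corresponding to `d`. -/
noncomputable def of (d : D) : FreeBooleanRing D := Ideal.Quotient.mk _ (MvPolynomial.X d)

theorem of_mul_self (d : D) : of d * of d = of d := by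
  rw [← pow_two, ← sub_eq_zero]
  exact Ideal.Quotient.eq_zero_iff_mem.2 (Ideal.subset_span ⟨d, rfl⟩)

theorem induction {p : FreeBooleanRing D → Prop} (h0 : p 0) (h1 : p 1)
    (hadd : ∀ x y, p x → p y → p (x + y)) (hmul : ∀ x d, p x → p (x * of d)) (x) : p x := by
  obtain ⟨q, rfl⟩ := Ideal.Quotient.mk_surjective x
  induction q using MvPolynomial.induction_on with
  | C c =>
    have : c = 0 ∨ c = 1 := by revert c; decide
    rcases this with rfl | rfl
    · simpa using h0
    · simpa using h1
  | add q r hq hr => rw [map_add]; exact hadd _ _ hq hr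
  | mul_X q d hq => rw [map_mul]; exact hmul _ _ hq

theorem add_self (x : FreeBooleanRing D) : x + x = 0 := by
  obtain ⟨q, rfl⟩ := Ideal.Quotient.mk_surjective x
  rw [← map_add, CharTwo.add_self_eq_zero, map_zero]

theorem mul_self (x : FreeBooleanRing D) : x * x = x := by
  induction x using FreeBooleanRing.induction with
  | h0 => simp
  | h1 => simp
  | hadd x y hx hy =>
    calc (x + y) * (x + y) = x * x + y * y + (x * y + x * y) := by ring
      _ = x + y := by rw [add_self, hx, hy, add_zero]
  | hmul x d hx =>
    calc x * of d * (x * of d) = (x * x) * (of d * of d) := by ring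
      _ = x * of d := by rw [hx, of_mul_self]

noncomputable instance : BooleanRing (FreeBooleanRing D) where
  isIdempotentElem := mul_self

theorem mk_le (D : Type u) :
    Cardinal.mk (FreeBooleanRing D) ≤ max Cardinal.aleph0 (Cardinal.mk D) := by
  have h := MvPolynomial.cardinalMk_le_max_lift (σ := D) (R := ZMod 2)
  refine (Cardinal.mk_le_of_surjective Ideal.Quotient.mk_surjective).trans (h.trans ?_)
  have : Cardinal.lift.{u} (Cardinal.mk (ZMod 2)) ≤ Cardinal.aleph0 := by
    rw [Cardinal.lift_le_aleph0]; exact (Cardinal.lt_aleph0_of_finite _).le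
  refine max_le (max_le ?_ ?_) ?_ <;> simp_all

theorem of_injective : Function.Injective (of : D → FreeBooleanRing D) := by
  classical
  intro d e hde
  by_contra hne
  -- Sending `d` to 1 and every other generator to 0 separates `of d` from `of e`.
  let φ : FreeBooleanRing D →+* ZMod 2 :=
    Ideal.Quotient.lift _ (MvPolynomial.eval fun x => if x = d then 1 else 0) fun p hp => by
      refine (RingHom.mem_ker).1 (Ideal.span_le.2 ?_ hp)
      rintro _ ⟨x, rfl⟩
      by_cases hx : x = d <;> simp [RingHom.mem_ker, hx]
  have := congrArg φ hde
  simp [φ, of, Ne.symm hne] at this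

/-- The endomorphism of the free Boolean ring induced by a selfmap. -/
noncomputable def map (f : D → D) : FreeBooleanRing D →+* FreeBooleanRing D :=
  Ideal.Quotient.lift _ ((Ideal.Quotient.mk _).comp (MvPolynomial.rename f).toRingHom)
    fun p hp => by
      refine (RingHom.mem_ker).1 (Ideal.span_le.2 ?_ hp)
      rintro _ ⟨x, rfl⟩
      have := of_mul_self (f x)
      rw [of, ← map_mul, ← sub_eq_zero, ← map_sub] at this
      simpa [RingHom.mem_ker, pow_two] using this

@[simp]
theorem map_of (f : D → D) (d : D) : map f (of d) = of (f d) := by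
  simp [map, of]

end FreeBooleanRing

variable {S : Type v} {D : Type u} [Monoid S] [TopologicalSpace S] {a : S → D → D}

/-- Local constancy passes from generators to sums and products, and the generators alone already
recover the topology of `S`. -/
theorem IsEmbeddingRightAction.freeBooleanRing (ha : IsEmbeddingRightAction a) :
    IsEmbeddingRightAction fun s (x : FreeBooleanRing D) => FreeBooleanRing.map (a s) x where
  t0 := ha.t0
  map_one x := by
    induction x using FreeBooleanRing.induction <;> simp_all [ha.map_one]
  map_mul s t x := by
    induction x using FreeBooleanRing.induction <;> simp_all [ha.map_mul]
  eventually_eq s₀ x := by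
    induction x using FreeBooleanRing.induction with
    | h0 => simp
    | h1 => simp
    | hadd x y hx hy => filter_upwards [hx, hy] with s h1 h2; simp [h1, h2]
    | hmul x d hx => filter_upwards [hx, ha.eventually_eq s₀ d] with s h1 h2; simp [h1, h2]
  exists_finite s₀ U hU := by
    obtain ⟨F, hF, hFU⟩ := ha.exists_finite s₀ U hU
    refine ⟨FreeBooleanRing.of '' F, hF.image _, fun s hs => hFU s fun d hd => ?_⟩
    have := hs _ ⟨d, hd, rfl⟩
    simp only [FreeBooleanRing.map_of] at this
    exact FreeBooleanRing.of_injective this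

theorem RingEndo.isEmbedding_toSelfMap (B : Type u) [Ring B] :
    IsEmbedding (RingEndo.toSelfMap (B := B)) :=
  ⟨⟨rfl⟩, fun _ _ h => RingHom.ext fun x => congrFun h x⟩

theorem IsEmbeddingRightAction.embeds_ringEndo (ha : IsEmbeddingRightAction a) :
    TopMonoidEmbeds Sᵐᵒᵖ (RingEndo (FreeBooleanRing D)) := by
  have hb := ha.freeBooleanRing
  let h : Sᵐᵒᵖ →* RingEndo (FreeBooleanRing D) :=
    { toFun := fun s => (FreeBooleanRing.map (a s.unop) : FreeBooleanRing D →+* FreeBooleanRing D)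
      map_one' := RingHom.ext hb.map_one
      map_mul' := fun s t => RingHom.ext (hb.map_mul t.unop s.unop) }
  exact ⟨h, ((RingEndo.isEmbedding_toSelfMap _).of_comp_iff (f := h)).1 hb.isEmbedding_hom⟩

end FreeBooleanRing

/-! ### Recovering discrete right actions -/

theorem TopMonoidEmbeds.selfMap_of_ringEndo {S : Type v} {B : Type u} [Monoid S]
    [TopologicalSpace S] [Ring B] (h : TopMonoidEmbeds Sᵐᵒᵖ (RingEndo B)) :
    TopMonoidEmbeds Sᵐᵒᵖ (SelfMap B) := by
  obtain ⟨h, hh⟩ := h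
  let h' : Sᵐᵒᵖ →* SelfMap B :=
    { toFun := fun s => (h s).toSelfMap
      map_one' := congrArg RingEndo.toSelfMap (map_one h)
      map_mul' := fun s t => congrArg RingEndo.toSelfMap (map_mul h s t) }
  exact ⟨h', (RingEndo.isEmbedding_toSelfMap B).comp hh⟩

/-- The finite set is hidden in the infimum of filters, so `exists_finite` can be checked on
subbasic neighbourhoods. -/
theorem exists_finite_of_iInf_principal_le {S : Type u} {D : Type v} {a : S → D → D} {s₀ : S}
    {l : Filter S} (h : ⨅ d, Filter.principal {s | a s d = a s₀ d} ≤ l) :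
    ∀ U ∈ l, ∃ F : Set D, F.Finite ∧ ∀ s, (∀ d ∈ F, a s d = a s₀ d) → s ∈ U := by
  intro U hU
  obtain ⟨F, hF, hFU⟩ := (Filter.hasBasis_iInf_principal_finite _).mem_iff.1 (h hU)
  exact ⟨F, hF, fun s hs => hFU (Set.mem_iInter₂.2 hs)⟩

theorem ContinuousMap.iInf_principal_le_comap_nhds {S : Type u} {ι : Type v} {X Y : Type*}
    [TopologicalSpace X] [TopologicalSpace Y] {F : S → C(X, Y)} {s₀ : S} {T : ι → Set S}
    (h : ∀ (K : Set X) (U : Set Y), IsCompact K → IsOpen U → Set.MapsTo (F s₀) K U →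
      {s | Set.MapsTo (F s) K U} ∈ ⨅ d, Filter.principal (T d)) :
    ⨅ d, Filter.principal (T d) ≤ Filter.comap F (𝓝 (F s₀)) := by
  rw [ContinuousMap.nhds_compactOpen, ← Filter.map_le_iff_le_comap]
  simp only [le_iInf_iff, Filter.le_principal_iff, Filter.mem_map]
  intro K hK U hU hm
  exact h K U hK hU hm

/-! ### Right congruences -/

section RightCongruence

variable {S : Type u} [Monoid S] [TopologicalSpace S] [ContinuousMul S] [T0Space S]

/-- A family of right congruences with open classes that generate the topology of `S` gives an
embedding of `Sᵐᵒᵖ` into the selfmaps of the set of all classes. -/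
theorem topMonoidEmbeds_selfMap_of_setoids {ι : Type u} (r : ι → Setoid S)
    (hmul : ∀ i x y s, r i x y → r i (x * s) (y * s))
    (hopen : ∀ i s₀, ∀ᶠ s in 𝓝 s₀, r i s s₀)
    (hnhds : ∀ s₀, ⨅ i, Filter.principal {s | r i s s₀} ≤ 𝓝 s₀) :
    TopMonoidEmbeds Sᵐᵒᵖ (SelfMap (Σ i, Quotient (r i))) := by
  let a : S → (Σ i, Quotient (r i)) → Σ i, Quotient (r i) := fun s d =>
    ⟨d.1, Quotient.map (· * s) (fun x y h => hmul d.1 x y s h) d.2⟩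
  have ha : ∀ s i x, a s ⟨i, Quotient.mk _ x⟩ = ⟨i, Quotient.mk _ (x * s)⟩ := fun _ _ _ => rfl
  have heq : ∀ i x y, (⟨i, Quotient.mk _ x⟩ : Σ i, Quotient (r i)) = ⟨i, Quotient.mk _ y⟩ ↔
      r i x y := fun i x y => by
    rw [Sigma.mk.injEq, heq_eq_eq, Quotient.eq]; simp
  refine IsEmbeddingRightAction.topMonoidEmbeds (a := a) ⟨inferInstance, ?_, ?_, ?_, fun s₀ => ?_⟩
  · rintro ⟨i, d⟩
    induction d using Quotient.inductionOn with | _ x => rw [ha, mul_one]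
  · rintro s t ⟨i, d⟩
    induction d using Quotient.inductionOn with | _ x => rw [ha, ha, ha, mul_assoc]
  · rintro s₀ ⟨i, d⟩
    induction d using Quotient.inductionOn with | _ x =>
    simp only [ha, heq]
    exact ((continuous_const_mul x).tendsto s₀).eventually (hopen i (x * s₀))
  · refine exists_finite_of_iInf_principal_le (le_trans (le_iInf fun i => ?_) (hnhds s₀))
    -- The class of 1 is moved to the class of `s`, so its image alone determines `s` up to `r i`.
    refine (iInf_le _ ⟨i, Quotient.mk _ 1⟩).trans (Filter.principal_mono.2 fun s hs => ?_)
    simpa only [Set.mem_ofPred_eq, ha, heq, one_mul] using hs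

/-- By the ultrametric inequality, being at distance less than `ε` is an equivalence relation; right
nonexpansiveness makes it a right congruence. -/
theorem HasRightNonexpansiveUltraUniformity.exists_selfMap
    (h : HasRightNonexpansiveUltraUniformity S) :
    ∃ D : Type u, TopMonoidEmbeds Sᵐᵒᵖ (SelfMap D) := by
  obtain ⟨U, hU, -, P, hP, hUP⟩ := h
  have hn : ∀ s₀ : S, 𝓝 s₀ = ⨅ ρ ∈ P, @nhds S ρ.toUniformSpace.toTopologicalSpace s₀ := by
    intro s₀
    rw [← hU, hUP, UniformSpace.toTopologicalSpace_iInf, nhds_iInf]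
    refine iInf_congr fun ρ => ?_
    rw [UniformSpace.toTopologicalSpace_iInf, nhds_iInf]
  let r : P × {ε : ℝ // 0 < ε} → Setoid S := fun i =>
    { r := fun x y => i.1.1.dist x y < i.2
      iseqv := ⟨fun x => by rw [i.1.1.dist_self]; exact i.2.2,
        fun {x y} h => by rwa [i.1.1.dist_comm],
        fun {x y z} h h' => ((hP _ i.1.2).1 x y z).trans_lt (max_lt h h')⟩ }
  have hball : ∀ (i : P × {ε : ℝ // 0 < ε}) (s₀ : S),
      {s | r i s s₀} = @Metric.ball S i.1.1 s₀ i.2 := fun i s₀ => rfl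
  refine ⟨_, topMonoidEmbeds_selfMap_of_setoids r
    (fun i x y s h => ((hP _ i.1.2).2 x y s).trans_lt h) (fun i s₀ => ?_) (fun s₀ => ?_)⟩
  · change {s | r i s s₀} ∈ _
    rw [hball, hn]
    exact Filter.mem_iInf_of_mem i.1.1 (Filter.mem_iInf_of_mem i.1.2
      (@Metric.ball_mem_nhds S i.1.1 s₀ i.2 i.2.2))
  · rw [hn]
    refine le_iInf₂ fun ρ hρ => fun V hV => ?_
    obtain ⟨ε, hε, hεV⟩ := (@Metric.mem_nhds_iff S ρ s₀ V).1 hV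
    refine Filter.mem_iInf_of_mem (⟨ρ, hρ⟩, ⟨ε, hε⟩) ?_
    rw [hball]
    exact hεV

end RightCongruence

section ToSelfMap

variable {S : Type u} [Monoid S] [TopologicalSpace S]

/-- For `m` in `M` and `ε > 0`, the relation `dist (e x m) (e y m) < ε` is a right congruence, as `e
(x * s) = e s ∘ e x` with `e s` 1-Lipschitz. -/
theorem TopMonoidEmbeds.exists_selfMap_of_nonexp [ContinuousMul S] {M : Type u} [MetricSpace M]
    [IsUltrametricDist M] (h : TopMonoidEmbeds Sᵐᵒᵖ (Nonexp M)) :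
    ∃ D : Type u, TopMonoidEmbeds Sᵐᵒᵖ (SelfMap D) := by
  obtain ⟨h, hh⟩ := h
  let e : S → M → M := fun s => (h (MulOpposite.op s)).1
  have he : IsEmbedding e :=
    (⟨⟨rfl⟩, Subtype.val_injective⟩ : IsEmbedding fun f : Nonexp M => f.1).comp
      (hh.comp MulOpposite.opHomeomorph.isEmbedding)
  have hmul : ∀ s t m, e (s * t) m = e t (e s m) := fun s t m =>
    congrFun (congrArg Subtype.val (MonoidHom.map_mul h (MulOpposite.op t) (MulOpposite.op s))) m
  have := he.t2Space
  let r : M × {ε : ℝ // 0 < ε} → Setoid S := fun i =>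
    { r := fun x y => dist (e x i.1) (e y i.1) < i.2
      iseqv := ⟨fun x => by rw [dist_self]; exact i.2.2,
        fun {x y} h => by rwa [dist_comm],
        fun {x y z} h h' => (dist_triangle_max _ _ _).trans_lt (max_lt h h')⟩ }
  refine ⟨_, topMonoidEmbeds_selfMap_of_setoids r (fun i x y s hxy => ?_) (fun i s₀ => ?_)
    (fun s₀ => ?_)⟩
  · change dist (e (x * s) i.1) (e (y * s) i.1) < i.2
    rw [hmul, hmul]
    exact ((h (MulOpposite.op s)).2 _ _).trans_lt hxy
  · have hc : Continuous fun s => e s i.1 := (continuous_apply i.1).comp he.continuous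
    exact (hc.tendsto s₀).eventually (Metric.ball_mem_nhds _ i.2.2)
  · rw [he.isInducing.nhds_eq_comap, nhds_pi, Filter.pi, Filter.comap_iInf]
    refine le_iInf fun m => ?_
    rw [Filter.comap_comap]
    intro V hV
    obtain ⟨ε, hε, hεV⟩ := (Metric.nhds_basis_ball.comap _).mem_iff.1 hV
    exact Filter.mem_iInf_of_mem ((m, ⟨ε, hε⟩) : M × {ε : ℝ // 0 < ε}) (Filter.mem_principal.2 hεV)

/-- Being uniformly `E`-close, for an equivalence entourage `E`, survives right multiplication,
which only restricts the points tested. -/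
theorem TopMonoidEmbeds.exists_selfMap_of_unifEnd [ContinuousMul S] {Y : Type u} [UniformSpace Y]
    [T2Space Y] [IsUltraUniformity Y] (h : TopMonoidEmbeds S (UnifEnd Y)) :
    ∃ D : Type u, TopMonoidEmbeds Sᵐᵒᵖ (SelfMap D) := by
  obtain ⟨h, hh⟩ := h
  let e : S → UniformFun Y Y := fun s => UniformFun.ofFun (h s).1
  have he : IsEmbedding e :=
    (⟨⟨rfl⟩, fun f g hfg => Subtype.ext hfg⟩ :
      IsEmbedding fun f : UnifEnd Y => UniformFun.ofFun f.1).comp hh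
  have hmul : ∀ s t y, (h (s * t)).1 y = (h s).1 ((h t).1 y) := fun s t y =>
    congrFun (congrArg Subtype.val (MonoidHom.map_mul h s t)) y
  have := he.t2Space
  let r : {E : SetRel Y Y // E ∈ 𝓤 Y ∧ E.IsSymm ∧ E.IsTrans} → Setoid S := fun i =>
    { r := fun s t => ∀ y, ((h t).1 y, (h s).1 y) ∈ i.1
      iseqv := ⟨fun s y => refl_mem_uniformity i.2.1,
        fun {s t} hst y => i.2.2.1.symm _ _ (hst y),
        fun {s t w} hst htw y => i.2.2.2.trans _ _ _ (htw y) (hst y)⟩ }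
  have hb : ∀ s₀, (𝓝 s₀).HasBasis (fun E : SetRel Y Y => E ∈ 𝓤 Y ∧ E.IsSymm ∧ E.IsTrans)
      fun E => {s | ∀ y, ((h s₀).1 y, (h s).1 y) ∈ E} := fun s₀ => by
    rw [he.isInducing.nhds_eq_comap]
    exact (UniformFun.hasBasis_nhds_of_basis Y Y (e s₀) IsUltraUniformity.hasBasis).comap _
  refine ⟨_, topMonoidEmbeds_selfMap_of_setoids r (fun i s t w hst y => ?_) (fun i s₀ => ?_)
    (fun s₀ => ?_)⟩
  · rw [hmul, hmul]
    exact hst _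
  · exact (hb s₀).mem_of_mem i.2
  · intro V hV
    obtain ⟨E, hE, hEV⟩ := (hb s₀).mem_iff.1 hV
    exact Filter.mem_iInf_of_mem ⟨E, hE⟩ (Filter.mem_principal.2 hEV)

theorem IsStoneSpace.totallyDisconnectedSpace {Y : Type u} [TopologicalSpace Y]
    (hY : IsStoneSpace Y) : TotallyDisconnectedSpace Y := by
  have := hY.t2
  have : TotallySeparatedSpace Y := totallySeparatedSpace_iff_exists_isClopen.2 fun x y hxy => ?_
  · infer_instance
  obtain ⟨C, hC, hxC, hCy⟩ := hY.clopen_basis.exists_subset_of_mem_open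
    (a := x) (u := {y}ᶜ) hxy isOpen_compl_singleton
  exact ⟨C, hC, hxC, fun hy => hCy hy rfl⟩

/-- `S` acts on the right on the clopen sets of `Y` by preimage. -/
theorem TopMonoidEmbeds.exists_selfMap_of_contEnd {Y : Type u} [TopologicalSpace Y]
    (hY : IsStoneSpace Y) (h : TopMonoidEmbeds S (ContEnd Y)) :
    ∃ D : Type u, TopMonoidEmbeds Sᵐᵒᵖ (SelfMap D) := by
  obtain ⟨h, hh⟩ := h
  have := hY.compact
  have := hY.t2
  have := hY.totallyDisconnectedSpace
  let e : S → C(Y, Y) := fun s => (h s).toContinuousMap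
  have he : IsEmbedding e := hh
  have hmul : ∀ s t y, e (s * t) y = e s (e t y) := fun s t y =>
    congrArg (fun f => ContEnd.toContinuousMap f y) (MonoidHom.map_mul h s t)
  have hone : ∀ y, e 1 y = y := fun y =>
    congrArg (fun f => ContEnd.toContinuousMap f y) (MonoidHom.map_one h)
  let a : S → {C : Set Y // IsClopen C} → {C : Set Y // IsClopen C} := fun s C =>
    ⟨e s ⁻¹' C.1, C.2.preimage (e s).continuous⟩
  refine ⟨_, IsEmbeddingRightAction.topMonoidEmbeds (a := a) ⟨?_, fun C => ?_, fun s t C => ?_,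
    fun s₀ C => ?_, fun s₀ => ?_⟩⟩
  · have := he.t2Space
    infer_instance
  · exact Subtype.ext (Set.ext fun y => by simp [a, hone])
  · exact Subtype.ext (Set.ext fun y => by simp [a, hmul])
  · have h1 := (e s₀).continuous
    -- The preimage of `C` stays the same while `e s` maps the compact set `e s₀ ⁻¹' C` into `C` and
    -- its complement into `Cᶜ`.
    have o1 := ContinuousMap.isOpen_setOfPred_mapsTo (X := Y) (Y := Y)
      (C.2.preimage h1).isClosed.isCompact C.2.isOpen
    have o2 := ContinuousMap.isOpen_setOfPred_mapsTo (X := Y) (Y := Y)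
      (C.2.compl.preimage h1).isClosed.isCompact C.2.compl.isOpen
    filter_upwards [(o1.preimage he.continuous).mem_nhds (x := s₀) fun y hy => hy,
      (o2.preimage he.continuous).mem_nhds (x := s₀) fun y hy => hy] with s hs1 hs2
    refine Subtype.ext (Set.Subset.antisymm (fun y hy => ?_) fun y hy => hs1 hy)
    by_contra hne
    exact hs2 hne hy
  · rw [he.isInducing.nhds_eq_comap]
    refine exists_finite_of_iInf_principal_le
      (ContinuousMap.iInf_principal_le_comap_nhds fun K U hK hU hKU => ?_)
    obtain ⟨C, hC, hKC, hCU⟩ : ∃ C : Set Y, IsClopen C ∧ e s₀ '' K ⊆ C ∧ C ⊆ U := by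
      exact exists_clopen_of_closed_subset_open (hK.image (e s₀).continuous).isClosed hU
        (Set.image_subset_iff.2 hKU)
    refine Filter.mem_iInf_of_mem ⟨C, hC⟩ fun s hs y hy => hCU ?_
    have := congrArg Subtype.val hs
    change e s ⁻¹' C = e s₀ ⁻¹' C at this
    change y ∈ e s ⁻¹' C
    rw [this]
    exact hKC ⟨y, hy, rfl⟩

/-- `S` acts on the right on the Pontryagin dual by precomposition. The dual of a compact group is
discrete, which gives local constancy. -/
theorem TopMonoidEmbeds.exists_selfMap_of_groupEnd {K : Type u} [CommGroup K] [TopologicalSpace K]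
    [IsTopologicalGroup K] [CompactSpace K] [T2Space K]
    (hsep : ∀ x : K, x ≠ 1 → ∃ χ : PontryaginDual K, χ x ≠ 1)
    (h : TopMonoidEmbeds S (GroupEnd K)) :
    ∃ D : Type u, TopMonoidEmbeds Sᵐᵒᵖ (SelfMap D) := by
  obtain ⟨h, hh⟩ := h
  let e : S → C(K, K) := fun s => ((h s).toHom : C(K, K))
  have he : IsEmbedding e :=
    (⟨⟨rfl⟩, fun f g hfg => ContinuousMonoidHom.ext fun x => DFunLike.congr_fun hfg x⟩ :
      IsEmbedding fun f : GroupEnd K => (f.toHom : C(K, K))).comp hh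
  have hmul : ∀ s t y, e (s * t) y = e s (e t y) := fun s t y =>
    congrArg (fun f => GroupEnd.toHom f y) (MonoidHom.map_mul h s t)
  have hone : ∀ y, e 1 y = y := fun y =>
    congrArg (fun f => GroupEnd.toHom f y) (MonoidHom.map_one h)
  let a : S → PontryaginDual K → PontryaginDual K := fun s χ =>
    ContinuousMonoidHom.comp (show K →ₜ* Circle from χ) (h s).toHom
  have ha : ∀ s χ x, a s χ x = χ (e s x) := fun _ _ _ => rfl
  refine ⟨_, IsEmbeddingRightAction.topMonoidEmbeds (a := a) ⟨?_, fun χ => ?_, fun s t χ => ?_,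
    fun s₀ χ => ?_, fun s₀ => ?_⟩⟩
  · have := he.t2Space
    infer_instance
  · exact PontryaginDual.ext fun x => by rw [ha, hone]
  · exact PontryaginDual.ext fun x => congrArg χ (hmul s t x)
  · have hc : Continuous fun s => a s χ := by
      refine continuous_induced_rng.2 ?_
      exact (ContinuousMap.continuous_postcomp
        ((show K →ₜ* Circle from χ) : C(K, Circle))).comp he.continuous
    exact ((isOpen_discrete {a s₀ χ}).preimage hc).mem_nhds rfl
  · rw [he.isInducing.nhds_eq_comap]
    refine exists_finite_of_iInf_principal_le
      (ContinuousMap.iInf_principal_le_comap_nhds fun L U hL hU hLU => ?_)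
    obtain ⟨V, hV, hVU⟩ := compact_open_separated_mul_right (hL.image (e s₀).continuous) hU
      (Set.image_subset_iff.2 hLU)
    obtain ⟨W, hWV, hW, h1W⟩ := mem_nhds_iff.1 hV
    -- By compactness of `Wᶜ`, finitely many characters have their common kernel inside `W`.
    obtain ⟨F, hF⟩ := hW.isClosed_compl.isCompact.elim_finite_subfamily_closed
      (fun χ : PontryaginDual K => {x | χ x = 1})
      (fun χ => isClosed_eq (map_continuous χ) continuous_const) (by
        refine Set.eq_empty_of_forall_notMem fun x hx => ?_
        obtain ⟨χ, hχ⟩ := hsep x fun hx1 => hx.1 (hx1 ▸ h1W)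
        exact hχ (Set.mem_iInter.1 hx.2 χ))
    refine Filter.mem_of_superset ((Filter.biInter_finset_mem F).2 fun χ _ =>
      Filter.mem_iInf_of_mem χ (Filter.mem_principal_self _)) fun s hs y hy => ?_
    have hker : (e s₀ y)⁻¹ * e s y ∈ W := by
      by_contra hne
      refine Set.notMem_empty ((e s₀ y)⁻¹ * e s y) (hF ▸ ⟨hne, Set.mem_iInter₂.2 fun χ hχ => ?_⟩)
      have := DFunLike.congr_fun (Set.mem_iInter₂.1 hs χ hχ) y
      rw [ha, ha] at this
      simp [this]
    have := hVU (Set.mul_mem_mul ⟨y, hy, rfl⟩ (hWV hker))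
    rwa [mul_inv_cancel_left] at this

end ToSelfMap

/-! ### Small discrete actions from a Stone compactification -/

section LeftNA

variable {S : Type u} [TopologicalSpace S]

/-- Each value is constant on some nonempty basic open set, and distinct values need distinct sets.
-/
theorem mk_range_le_weight {X : Type u} {f : S → X} (hf : ∀ s₀, ∀ᶠ s in 𝓝 s₀, f s = f s₀) :
    Cardinal.mk (Set.range f) ≤ weight S := by
  obtain ⟨b, hb, hbw⟩ := exists_basis_mk_eq_weight S
  rw [← hbw]
  have h : ∀ x : Set.range f, ∃ v : b, v.1.Nonempty ∧ ∀ s ∈ v.1, f s = x := by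
    rintro ⟨_, s₀, rfl⟩
    obtain ⟨v, hv, hs, hvf⟩ := hb.mem_nhds_iff.1 (hf s₀)
    exact ⟨⟨v, hv⟩, ⟨s₀, hs⟩, hvf⟩
  choose v hne hv using h
  refine Cardinal.mk_le_of_injective (f := v) fun x y hxy => Subtype.ext ?_
  obtain ⟨s, hs⟩ := hne x
  rw [← hv x s hs, hv y s (hxy ▸ hs)]

/-- For a space embedded in a Stone space, there are at most `w * w` many clopen sets of the Stone
space that induce the topology, where `w` is the weight of the embedded space. -/
theorem exists_small_clopen_family {Y : Type u} [TopologicalSpace Y]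
    (hY : IsStoneSpace Y) {ν : S → Y} (hν : IsEmbedding ν) :
    ∃ A : Set (Set Y), Cardinal.mk A ≤ weight S * weight S ∧ (∀ C ∈ A, IsClopen C) ∧
      ∀ s₀, ∀ U ∈ 𝓝 s₀, ∃ C ∈ A, ν s₀ ∈ C ∧ ν ⁻¹' C ⊆ U := by
  obtain ⟨b, hb, hbw⟩ := exists_basis_mk_eq_weight S
  -- One clopen set is chosen for each pair of basic sets that the trace of some clopen set
  -- interpolates.
  let P : Set (b × b) := {p | ∃ C : Set Y, IsClopen C ∧ p.1.1 ⊆ ν ⁻¹' C ∧ ν ⁻¹' C ⊆ p.2.1}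
  choose C hC using fun p : P => p.2
  refine ⟨Set.range C, ?_, ?_, fun s₀ U hU => ?_⟩
  · refine Cardinal.mk_range_le.trans ((Cardinal.mk_set_le P).trans ?_)
    rw [Cardinal.mk_prod, Cardinal.lift_id, hbw]
  · rintro _ ⟨p, rfl⟩
    exact (hC p).1
  · obtain ⟨V, hV, hsV, hVU⟩ := hb.mem_nhds_iff.1 hU
    obtain ⟨W, hW, rfl⟩ := hν.isInducing.isOpen_iff.1 (hb.isOpen hV)
    obtain ⟨E, hE, hsE, hEW⟩ := hY.clopen_basis.exists_subset_of_mem_open hsV hW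
    obtain ⟨V', hV', hsV', hVE⟩ := hb.exists_subset_of_mem_open (u := ν ⁻¹' E) hsE
      (hE.isOpen.preimage hν.continuous)
    let p : P := ⟨(⟨V', hV'⟩, ⟨ν ⁻¹' W, hV⟩), E, hE, hVE, Set.preimage_mono hEW⟩
    exact ⟨C p, ⟨p, rfl⟩, (hC p).2.1 hsV', (hC p).2.2.trans hVU⟩

variable [Monoid S]

/-- Membership of `s • y` in `C` is locally constant in `(s, y)`; compactness of `Y` makes the
neighbourhood of `s₀` independent of `y`. -/
theorem eventually_preimage_smul_eq {Y : Type v} [TopologicalSpace Y] [CompactSpace Y]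
    [MulAction S Y] [ContinuousSMul S Y] {C : Set Y} (hC : IsClopen C) (s₀ : S) :
    ∀ᶠ s in 𝓝 s₀, {y | s • y ∈ C} = {y : Y | s₀ • y ∈ C} := by
  have h : ∀ᶠ s in 𝓝 s₀, ∀ y ∈ Set.univ, (s • y ∈ C ↔ s₀ • y ∈ C) := by
    refine isCompact_univ.eventually_forall_of_forall_eventually fun y _ => ?_
    have h1 : IsClopen {z : S × Y | z.1 • z.2 ∈ C} := hC.preimage continuous_smul
    have h2 : IsClopen {z : S × Y | s₀ • z.2 ∈ C} :=
      hC.preimage (continuous_const.smul continuous_snd)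
    by_cases hy : s₀ • y ∈ C
    · filter_upwards [h1.isOpen.mem_nhds (x := (s₀, y)) hy, h2.isOpen.mem_nhds (x := (s₀, y)) hy]
        with z hz1 hz2 using iff_of_true hz1 hz2
    · filter_upwards [h1.compl.isOpen.mem_nhds (x := (s₀, y)) hy,
        h2.compl.isOpen.mem_nhds (x := (s₀, y)) hy] with z hz1 hz2 using iff_of_false hz1 hz2
  filter_upwards [h] with s hs
  exact Set.ext fun y => hs y trivial

theorem IsLeftNA.exists_selfMap (h : IsLeftNA S) :
    ∃ D : Type u, Cardinal.mk D ≤ weight S ∧ TopMonoidEmbeds Sᵐᵒᵖ (SelfMap D) := by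
  obtain ⟨Y, _, _, ν, hY, _, hν, -, hνs⟩ := h
  have := hY.compact
  have := hY.t2
  have := hν.t2Space
  -- For finite weight the bound `w * w` is too large; `S` is then finite discrete and acts on
  -- itself by right multiplication.
  rcases lt_or_ge (weight S) Cardinal.aleph0 with hw | hw
  · have := finite_of_weight_lt_aleph0 hw
    refine ⟨S, mk_le_weight_of_discrete S, IsEmbeddingRightAction.topMonoidEmbeds
      (a := fun s x => x * s) ⟨inferInstance, fun x => mul_one x, fun s t x => (mul_assoc x s t).symm,
        fun s₀ x => ?_, fun s₀ U hU => ⟨{1}, Set.finite_singleton 1, fun s hs => ?_⟩⟩⟩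
    · simp only [nhds_discrete, Filter.eventually_pure]
    · have : s = s₀ := by simpa using hs
      exact this ▸ mem_of_mem_nhds hU
  obtain ⟨A, hA, hAc, hAn⟩ := exists_small_clopen_family hY hν
  let p : S → Set Y → Set Y := fun s C => {y | s • y ∈ C}
  have hp1 : ∀ C, p 1 C = C := fun C => by simp [p]
  have hpm : ∀ s t C, p (s * t) C = p t (p s C) := fun s t C => by
    ext y; simp [p, mul_smul]
  let T : Set (Set Y) := ⋃ C : A, Set.range fun s => p s C.1
  have hT : ∀ s, ∀ C ∈ T, p s C ∈ T := by
    intro s C hC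
    obtain ⟨⟨C, hCA⟩, t, rfl⟩ := Set.mem_iUnion.1 hC
    exact Set.mem_iUnion.2 ⟨⟨C, hCA⟩, t * s, hpm t s C⟩
  have hAT : ∀ C ∈ A, C ∈ T := fun C hC => Set.mem_iUnion.2 ⟨⟨C, hC⟩, 1, hp1 C⟩
  have hTc : ∀ C ∈ T, IsClopen C := by
    intro C hC
    obtain ⟨⟨C, hCA⟩, t, rfl⟩ := Set.mem_iUnion.1 hC
    exact (hAc C hCA).preimage (continuous_const_smul t)
  refine ⟨T, ?_, IsEmbeddingRightAction.topMonoidEmbeds (a := fun s C => ⟨p s C, hT s C C.2⟩)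
    ⟨inferInstance, fun C => Subtype.ext (hp1 C), fun s t C => Subtype.ext (hpm s t C),
      fun s₀ C => ?_, fun s₀ U hU => ?_⟩⟩
  · have hww : weight S * weight S = weight S := Cardinal.mul_eq_self hw
    refine (Cardinal.mk_iUnion_le _).trans ?_
    rw [hww] at hA
    refine (mul_le_mul' hA (ciSup_le' fun C => ?_)).trans hww.le
    exact mk_range_le_weight (eventually_preimage_smul_eq (hAc C C.2))
  · exact (eventually_preimage_smul_eq (hTc C C.2) s₀).mono fun s hs => Subtype.ext hs
  · obtain ⟨C, hC, hsC, hCU⟩ := hAn s₀ U hU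
    refine ⟨{⟨C, hAT C hC⟩}, Set.finite_singleton _, fun s hs => hCU ?_⟩
    have h1 : p s C = p s₀ C := congrArg Subtype.val (hs _ rfl)
    -- Since `ν s = s • ν 1`, the preimage of `C` under `s` decides whether `ν s` lies in `C`.
    have h2 : ν 1 ∈ p s₀ C := by
      change s₀ • ν 1 ∈ C
      rwa [← hνs, smul_eq_mul, mul_one]
    rw [← h1] at h2
    change s • ν 1 ∈ C at h2
    rwa [← hνs, smul_eq_mul, mul_one] at h2

end LeftNA

/-! ### Characters of compact abelian groups -/

section Characters

open MeasureTheory InnerProductSpace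

variable {H : Type*} [NormedAddCommGroup H] [InnerProductSpace ℂ H]

theorem integrable_smul_rep {K : Type*} [CommGroup K] [TopologicalSpace K]
    [CompactSpace K] [MeasurableSpace K] [BorelSpace K] (μ : Measure K) [IsFiniteMeasure μ] {l : K →* (H →L[ℂ] H)}
    (hc : ∀ f, Continuous fun x => l x f) (φ : C(K, ℂ)) (f : H) :
    Integrable (fun y => φ y • l y f) μ :=
  (φ.continuous.smul (hc f)).integrable_of_hasCompactSupport (.of_compactSpace _)

variable [CompleteSpace H]

theorem star_rep_eq {G : Type*} [Group G] (l : G →* (H →L[ℂ] H)) (hn : ∀ x f, ‖l x f‖ = ‖f‖) (x : G) :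
    star (l x) = l x⁻¹ := by
  have hinner : ∀ f g, inner ℂ (l x f) (l x g) = inner ℂ f g := by
    let i : H →ₗᵢ[ℂ] H := ⟨(l x : H →ₗ[ℂ] H), hn x⟩
    exact i.inner_map_map
  refine ContinuousLinearMap.ext fun f => ext_inner_right ℂ fun g => ?_
  rw [ContinuousLinearMap.star_eq_adjoint, ContinuousLinearMap.adjoint_inner_left, ← hinner (l x⁻¹ f) g]
  congr 1
  change f = (l x * l x⁻¹) f
  rw [← map_mul, mul_inv_cancel, map_one]
  rfl

variable {K : Type*} [CommGroup K] [TopologicalSpace K] [IsTopologicalGroup K] [CompactSpace K]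
  [MeasurableSpace K] [BorelSpace K]

/-- The operator `∫ φ(y) l(y) dμ(y)` for an isometric representation `l`. -/
noncomputable def repAverage (μ : Measure K) [IsFiniteMeasure μ] (l : K →* (H →L[ℂ] H))
    (hn : ∀ x f, ‖l x f‖ = ‖f‖) (hc : ∀ f, Continuous fun x => l x f) (φ : C(K, ℂ)) :
    H →L[ℂ] H :=
  LinearMap.mkContinuous
    { toFun := fun f => ∫ y, φ y • l y f ∂μ
      map_add' := fun f g => by
        rw [← integral_add (integrable_smul_rep μ hc φ f) (integrable_smul_rep μ hc φ g)]
        simp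
      map_smul' := fun c f => by
        rw [RingHom.id_apply, ← integral_smul]
        simp [smul_comm c] } (‖φ‖ * μ.real Set.univ) fun f => by
    refine (norm_integral_le_of_norm_le_const (C := ‖φ‖ * ‖f‖) (.of_forall fun y => ?_)).trans
      (le_of_eq (by ring))
    rw [norm_smul, hn]
    exact mul_le_mul_of_nonneg_right (φ.norm_coe_le_norm y) (norm_nonneg f)

section

variable {μ : Measure K} [IsFiniteMeasure μ] {l : K →* (H →L[ℂ] H)}
  {hn : ∀ x f, ‖l x f‖ = ‖f‖} {hc : ∀ f, Continuous fun x => l x f}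

omit [CompleteSpace H] [IsTopologicalGroup K] in
theorem repAverage_apply (φ : C(K, ℂ)) (f : H) :
    repAverage μ l hn hc φ f = ∫ y, φ y • l y f ∂μ := rfl

omit [CompleteSpace H] [IsTopologicalGroup K] in
theorem norm_repAverage_sub_le (φ ψ : C(K, ℂ)) :
    ‖repAverage μ l hn hc φ - repAverage μ l hn hc ψ‖ ≤ ‖φ - ψ‖ * μ.real Set.univ := by
  have : repAverage μ l hn hc φ - repAverage μ l hn hc ψ = repAverage μ l hn hc (φ - ψ) := by
    ext f
    simp only [sub_apply, repAverage_apply, ContinuousMap.sub_apply, sub_smul]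
    exact (integral_sub (integrable_smul_rep μ hc φ f) (integrable_smul_rep μ hc ψ f)).symm
  rw [this]
  exact LinearMap.mkContinuous_norm_le _ (by positivity) _

omit [IsTopologicalGroup K] in
theorem commute_repAverage {A : H →L[ℂ] H} (hA : ∀ y, Commute A (l y)) (φ : C(K, ℂ)) :
    Commute A (repAverage μ l hn hc φ) := by
  refine ContinuousLinearMap.ext fun f => ?_
  change A (repAverage μ l hn hc φ f) = repAverage μ l hn hc φ (A f)
  rw [repAverage_apply, repAverage_apply,
    ← ContinuousLinearMap.integral_comp_comm A (integrable_smul_rep μ hc φ f)]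
  congr 1
  ext y
  rw [map_smul]
  exact congrArg (φ y • ·) (DFunLike.congr_fun (hA y) f)

theorem mul_repAverage [μ.IsMulLeftInvariant] (x : K) (φ : C(K, ℂ)) :
    l x * repAverage μ l hn hc φ =
      repAverage μ l hn hc (φ.comp (ContinuousMap.mulLeft x⁻¹)) := by
  refine ContinuousLinearMap.ext fun f => ?_
  change l x (repAverage μ l hn hc φ f) = _
  rw [repAverage_apply, repAverage_apply,
    ← ContinuousLinearMap.integral_comp_comm (l x) (integrable_smul_rep μ hc φ f),
    ← integral_mul_left_eq_self (fun y => φ.comp (ContinuousMap.mulLeft x⁻¹) y • l y f) x]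
  congr 1
  ext y
  simp

/-- `l` is only assumed strongly continuous. Composition with an average is norm continuous, because
translating `φ` is continuous in the sup norm. -/
theorem continuous_mul_repAverage [μ.IsMulLeftInvariant] (φ : C(K, ℂ)) :
    Continuous fun x => l x * repAverage μ l hn hc φ := by
  simp only [mul_repAverage]
  have h1 : Continuous fun x : K => φ.comp (ContinuousMap.mulLeft x⁻¹) :=
    ContinuousMap.continuous_of_continuous_uncurry _
      (φ.continuous.comp (continuous_fst.inv.mul continuous_snd))
  refine Continuous.comp (g := repAverage μ l hn hc) ?_ h1
  refine (LipschitzWith.of_dist_le_mul (K := ⟨μ.real Set.univ, measureReal_nonneg⟩)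
    fun φ ψ => ?_).continuous
  rw [dist_eq_norm, dist_eq_norm, mul_comm]
  exact norm_repAverage_sub_le φ ψ

omit [IsTopologicalGroup K] in
theorem exists_repAverage_ne_zero [μ.IsOpenPosMeasure] {g : H} (hg : g ≠ 0) :
    ∃ φ, repAverage μ l hn hc φ g ≠ 0 := by
  by_contra! h
  -- Averaging against the conjugate of this matrix coefficient yields `∫ ‖c‖²`, which is positive
  -- because `c 1 = ‖g‖²`.
  let c : C(K, ℂ) := ⟨fun y => inner ℂ g (l y g), continuous_const.inner (hc g)⟩
  have h1 : inner ℂ g (repAverage μ l hn hc (star c) g) = ((∫ y, ‖c y‖ ^ 2 ∂μ : ℝ) : ℂ) := by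
    rw [repAverage_apply, ← integral_inner (integrable_smul_rep μ hc (star c) g),
      ← integral_complex_ofReal]
    congr 1
    ext y
    rw [inner_smul_right]
    exact (Complex.conj_mul' (c y)).trans (by push_cast; rfl)
  rw [h, inner_zero_right] at h1
  have hpos : 0 < ∫ y, ‖c y‖ ^ 2 ∂μ := by
    refine Continuous.integral_pos_of_hasCompactSupport_nonneg_nonzero (x := (1 : K))
      (by fun_prop) (.of_compactSpace _) (fun y => by positivity) ?_
    simp [c, hg]
  exact hpos.ne (Complex.ofReal_injective (by simpa using h1))

end

/-- An isometric representation of a compact abelian group that does not kill `x` yields a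
continuous character that does not kill `x`. -/
theorem exists_character_of_rep (μ : Measure K) [IsFiniteMeasure μ] [μ.IsMulLeftInvariant]
    [μ.IsOpenPosMeasure] (l : K →* (H →L[ℂ] H)) (hn : ∀ x f, ‖l x f‖ = ‖f‖)
    (hc : ∀ f, Continuous fun x => l x f) {x₀ : K} (hx₀ : l x₀ ≠ 1) :
    ∃ χ : PontryaginDual K, χ x₀ ≠ 1 := by
  obtain ⟨f, hf⟩ : ∃ f, l x₀ f - f ≠ 0 := by
    by_contra! h
    exact hx₀ (ContinuousLinearMap.ext fun f => sub_eq_zero.1 (h f))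
  obtain ⟨φ, hφ⟩ := exists_repAverage_ne_zero (μ := μ) (l := l) (hn := hn) (hc := hc) hf
  let T := repAverage μ l hn hc
  -- Averages, group operators and their adjoints all commute, so they generate a commutative
  -- C*-algebra.
  let s : Set (H →L[ℂ] H) := Set.range T ∪ Set.range l
  have hll : ∀ x y, Commute (l x) (l y) := fun x y => by
    rw [commute_iff_eq, ← map_mul, mul_comm, map_mul]
  have hlT : ∀ x φ, Commute (l x) (T φ) := fun x φ => commute_repAverage (hll x) φ
  have hlT' : ∀ x φ, Commute (l x) (star (T φ)) := fun x φ => by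
    have := (hlT x⁻¹ φ).star_star
    rwa [star_rep_eq l hn, inv_inv] at this
  have hcomm : ∀ a ∈ s, ∀ b ∈ s, a * b = b * a := by
    rintro _ (⟨φ, rfl⟩ | ⟨x, rfl⟩) _ (⟨ψ, rfl⟩ | ⟨y, rfl⟩)
    · exact commute_repAverage (fun y => (hlT y φ).symm) ψ
    · exact (hlT y φ).symm
    · exact hlT x ψ
    · exact hll x y
  have hcomm' : ∀ a ∈ s, ∀ b ∈ s, a * star b = star b * a := by
    rintro _ (⟨φ, rfl⟩ | ⟨x, rfl⟩) _ (⟨ψ, rfl⟩ | ⟨y, rfl⟩)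
    · exact (commute_repAverage (fun y => (hlT' y ψ).symm) φ).symm
    · rw [star_rep_eq l hn]; exact (hlT _ φ).symm
    · exact hlT' x ψ
    · rw [star_rep_eq l hn]; exact hll _ _
  have hA := StarAlgebra.isMulCommutative_adjoin ℂ hcomm hcomm'
  let A := (StarAlgebra.adjoin ℂ s).topologicalClosure
  have hAclosed : IsClosed (A : Set (H →L[ℂ] H)) := StarSubalgebra.isClosed_topologicalClosure _
  have hAcomm : ∀ a b : A, a * b = b * a :=
    (StarSubalgebra.commRingTopologicalClosure (StarAlgebra.adjoin ℂ s) fun a b =>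
      hA.is_comm.comm a b).mul_comm
  let _ : CommCStarAlgebra A := { (inferInstance : CStarAlgebra A) with mul_comm := hAcomm }
  have hsA : s ⊆ A := (StarAlgebra.subset_adjoin ℂ s).trans
    (StarSubalgebra.le_topologicalClosure _)
  let L : K →* A :=
    { toFun := fun x => ⟨l x, hsA (Or.inr ⟨x, rfl⟩)⟩
      map_one' := Subtype.ext (map_one l)
      map_mul' := fun x y => Subtype.ext (map_mul l x y) }
  let t : A := ⟨T φ, hsA (Or.inl ⟨φ, rfl⟩)⟩
  -- A Gelfand character nonzero on this product satisfies both `χ t ≠ 0`, used for continuity, and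
  -- `χ (L x₀) ≠ 1`.
  have hne : t * (L x₀ - 1) ≠ 0 := fun h =>
    hφ (DFunLike.congr_fun (congrArg Subtype.val h) f)
  obtain ⟨χ, hχ⟩ : ∃ χ : WeakDual.characterSpace ℂ A, χ (t * (L x₀ - 1)) ≠ 0 := by
    by_contra! h
    refine hne ((gelfandTransform_isometry A).injective ?_)
    rw [map_zero]
    exact ContinuousMap.ext h
  rw [map_mul, map_sub, map_one] at hχ
  have hχt : χ t ≠ 0 := left_ne_zero_of_mul hχ
  have hle : ∀ x, ‖χ (L x)‖ ≤ 1 := fun x => by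
    have h1 : ∀ y, ‖L y‖ ≤ 1 := fun y =>
      ContinuousLinearMap.opNorm_le_bound _ zero_le_one fun f => by
        rw [one_mul]; exact (hn y f).le
    have h2 : ‖(1 : A)‖ ≤ 1 := map_one L ▸ h1 1
    refine (spectrum.norm_le_norm_mul_of_mem (AlgHom.apply_mem_spectrum χ (L x))).trans ?_
    exact mul_le_one₀ (h1 x) (norm_nonneg _) h2
  have hnorm : ∀ x, ‖χ (L x)‖ = 1 := fun x => by
    refine le_antisymm (hle x) ?_
    have h1 : χ (L x) * χ (L x⁻¹) = 1 := by rw [← map_mul, ← map_mul, mul_inv_cancel, map_one, map_one]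
    have h2 : ‖χ (L x)‖ * ‖χ (L x⁻¹)‖ = 1 := by rw [← norm_mul, h1, norm_one]
    calc (1 : ℝ) = ‖χ (L x)‖ * ‖χ (L x⁻¹)‖ := h2.symm
      _ ≤ ‖χ (L x)‖ * 1 := mul_le_mul_of_nonneg_left (hle _) (norm_nonneg _)
      _ = _ := mul_one _
  have hcont : Continuous fun x => χ (L x) := by
    have h1 : Continuous fun x => L x * t :=
      Continuous.subtype_mk (continuous_mul_repAverage (hn := hn) (hc := hc) φ) _
    -- Division by `χ t` transfers the norm continuity of `L x * t` to the character.
    have h2 : (fun x => χ (L x)) = fun x => χ (L x * t) / χ t := by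
      ext x
      rw [map_mul, mul_div_cancel_right₀ _ hχt]
    rw [h2]
    exact ((map_continuous χ).comp h1).div_const _
  let ψ : K →ₜ* Circle :=
    { toFun := fun x => ⟨χ (L x), mem_sphere_zero_iff_norm.2 (hnorm x)⟩
      map_one' := Subtype.ext (by simp)
      map_mul' := fun x y => Subtype.ext ((congrArg χ (map_mul L x y)).trans (map_mul χ _ _))
      continuous_toFun := hcont.subtype_mk _ }
  refine ⟨ψ, fun h => right_ne_zero_of_mul hχ (sub_eq_zero.2 ?_)⟩
  exact congrArg Subtype.val h

/-- Continuous characters separate the points of a compact abelian group. -/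
theorem exists_pontryaginDual_apply_ne_one {K : Type*} [CommGroup K] [TopologicalSpace K]
    [IsTopologicalGroup K] [CompactSpace K] [T2Space K] {x₀ : K} (hx₀ : x₀ ≠ 1) :
    ∃ χ : PontryaginDual K, χ x₀ ≠ 1 := by
  let _ : MeasurableSpace K := borel K
  have : BorelSpace K := ⟨rfl⟩
  let μ : Measure K := Measure.haar
  have : Fact ((2 : ENNReal) ≠ ⊤) := ⟨ENNReal.ofNat_ne_top⟩
  let l : K →* (Lp ℂ 2 μ →L[ℂ] Lp ℂ 2 μ) :=
    { toFun := fun x => LinearMap.mkContinuous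
        { toFun := fun f => DomMulAct.mk x • f
          map_add' := smul_add _
          map_smul' := fun c f => smul_comm _ c f } 1 fun f => by
            rw [one_mul]; exact (DomMulAct.norm_smul_Lp _ f).le
      map_one' := ContinuousLinearMap.ext fun f => one_smul Kᵈᵐᵃ f
      map_mul' := fun x y => ContinuousLinearMap.ext fun f => by
        rw [mul_comm]
        exact mul_smul (DomMulAct.mk x) (DomMulAct.mk y) f }
  have hl : ∀ x f, l x f = DomMulAct.mk x • f := fun _ _ => rfl
  refine exists_character_of_rep μ l (fun x f => DomMulAct.norm_smul_Lp _ f)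
    (fun f => (DomMulAct.continuous_mk.smul continuous_const)) fun h => ?_
  -- If `x₀` acted trivially, `φ (x₀ * x) = φ x` would hold almost everywhere, hence everywhere by
  -- continuity; `x = 1` contradicts this.
  obtain ⟨φ, hφ1, hφ⟩ : ∃ φ : C(K, ℂ), φ 1 = 0 ∧ φ x₀ = 1 := by
    obtain ⟨g, h0, h1, -⟩ := exists_continuous_zero_one_of_isClosed (isClosed_singleton (x := (1 : K)))
      (isClosed_singleton (x := x₀)) (by simpa using hx₀.symm)
    exact ⟨⟨fun x => (g x : ℂ), by fun_prop⟩, by simp [h0 rfl], by simp [h1 rfl]⟩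
  have hm : MemLp φ 2 μ := φ.continuous.memLp_of_hasCompactSupport (.of_compactSpace _)
  have h1 := congrArg (fun A => A (hm.toLp φ)) h
  simp only [hl, DomMulAct.mk_smul_toLp] at h1
  have h2 : (fun x => φ (x₀ * x)) =ᵐ[μ] φ := (MemLp.toLp_eq_toLp_iff _ hm).1 h1
  have h3 := (Continuous.ae_eq_iff_eq μ (by fun_prop) φ.continuous).1 h2
  have := congrFun h3 1
  simp [hφ, hφ1] at this

end Characters

/-- A profinite Boolean group is commutative. -/
theorem IsProfiniteBooleanGroup.mul_comm {K : Type u} [Group K] [TopologicalSpace K]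
    (hK : IsProfiniteBooleanGroup K) (x y : K) : x * y = y * x := by
  have hinv : ∀ z : K, z⁻¹ = z := fun z => inv_eq_of_mul_eq_one_left (hK.mul_self z)
  rw [← hinv (x * y), mul_inv_rev, hinv, hinv]

/-! ### Exact weights and the equivalences -/

theorem embeds_contEnd_of_discrete (S : Type u) [Monoid S] [TopologicalSpace S]
    [DiscreteTopology S] : TopMonoidEmbeds S (ContEnd S) := by
  let h : S →* ContEnd S :=
    { toFun := fun s => (⟨fun x => s * x, continuous_of_discreteTopology⟩ : C(S, S))
      map_one' := ContinuousMap.ext fun x => one_mul x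
      map_mul' := fun s t => ContinuousMap.ext fun x => mul_assoc s t x }
  refine ⟨h, IsEmbedding.of_comp (g := fun f : C(S, S) => f 1) continuous_of_discreteTopology
    (continuous_eval_const _) ?_⟩
  convert IsEmbedding.id (X := S)
  ext s
  exact mul_one s

/-- The cube has the right weight when `w(S)` is infinite; otherwise `S` is finite discrete and
serves as its own Stone space. -/
theorem exists_stoneSpace_weight_eq {S : Type u} [Monoid S] [TopologicalSpace S] {D : Type u}
    (hD : Cardinal.mk D ≤ weight S) {a : S → D → D} (ha : IsEmbeddingRightAction a) :
    ∃ (Y : Type u) (_ : TopologicalSpace Y),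
      IsStoneSpace Y ∧ weight Y = weight S ∧ TopMonoidEmbeds S (ContEnd Y) := by
  rcases lt_or_ge (weight S) Cardinal.aleph0 with hw | hw
  · have := ha.t0
    have := finite_of_weight_lt_aleph0 hw
    have : T2Space S := ha.isEmbedding.t2Space
    exact ⟨S, inferInstance, .of_totallyDisconnected S, rfl, embeds_contEnd_of_discrete S⟩
  · exact ⟨D × D → Bool, inferInstance, .of_totallyDisconnected _,
      ((weight_square_cube_le D Bool).trans (max_le hw hD)).antisymm ha.weight_le_cube,
      ha.embeds_contEnd_cube⟩

/-- The nine conditions are equivalent with the bounds on weights and cardinalities (first part)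
and also without them (second part). For finite `S` the bound in the conditions on `B` and on the
compact groups `K` is `ℵ₀`; for infinite `S` satisfying any of the conditions, `weight S` is
infinite and the maximum is `weight S`. -/
theorem theorem1p1 (S : Type u) [Monoid S] [TopologicalSpace S] [ContinuousMul S] :
    List.TFAE [
      IsLeftNA S,
      ∃ (Y : Type u) (_ : TopologicalSpace Y),
        IsStoneSpace Y ∧ weight Y = weight S ∧ TopMonoidEmbeds S (ContEnd Y),
      ∃ (B : Type u) (_ : BooleanRing B),
        Cardinal.mk B ≤ max Cardinal.aleph0 (weight S) ∧ TopMonoidEmbeds Sᵐᵒᵖ (RingEndo B),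
      ∃ D : Type u,
        Cardinal.mk D ≤ weight S ∧ TopMonoidEmbeds Sᵐᵒᵖ (SelfMap D),
      ∃ (M : Type u) (_ : MetricSpace M),
        IsUltrametricDist M ∧ weight M ≤ weight S ∧ TopMonoidEmbeds Sᵐᵒᵖ (Nonexp M),
      HasRightNonexpansiveUltraUniformity S,
      ∃ (Y : Type u) (_ : UniformSpace Y),
        T2Space Y ∧ IsUltraUniformity Y ∧ TopMonoidEmbeds S (UnifEnd Y),
      ∃ (K : Type u) (_ : Group K) (_ : TopologicalSpace K),
        IsProfiniteBooleanGroup K ∧ weight K ≤ max Cardinal.aleph0 (weight S) ∧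
          TopMonoidEmbeds S (GroupEnd K),
      ∃ (K : Type u) (_ : CommGroup K) (_ : TopologicalSpace K),
        IsCompactGroup K ∧ weight K ≤ max Cardinal.aleph0 (weight S) ∧
          TopMonoidEmbeds S (GroupEnd K)] ∧
    List.TFAE [
      IsLeftNA S,
      ∃ (Y : Type u) (_ : TopologicalSpace Y),
        IsStoneSpace Y ∧ TopMonoidEmbeds S (ContEnd Y),
      ∃ (B : Type u) (_ : BooleanRing B), TopMonoidEmbeds Sᵐᵒᵖ (RingEndo B),
      ∃ D : Type u, TopMonoidEmbeds Sᵐᵒᵖ (SelfMap D),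
      ∃ (M : Type u) (_ : MetricSpace M),
        IsUltrametricDist M ∧ TopMonoidEmbeds Sᵐᵒᵖ (Nonexp M),
      HasRightNonexpansiveUltraUniformity S,
      ∃ (Y : Type u) (_ : UniformSpace Y),
        T2Space Y ∧ IsUltraUniformity Y ∧ TopMonoidEmbeds S (UnifEnd Y),
      ∃ (K : Type u) (_ : Group K) (_ : TopologicalSpace K),
        IsProfiniteBooleanGroup K ∧ TopMonoidEmbeds S (GroupEnd K),
      ∃ (K : Type u) (_ : CommGroup K) (_ : TopologicalSpace K),
        IsCompactGroup K ∧ TopMonoidEmbeds S (GroupEnd K)] := by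
  -- Each unbounded condition implies the first, which returns the bounded form; this settles both
  -- lists.
  have toSelfMap : IsLeftNA S → ∃ D : Type u,
      Cardinal.mk D ≤ weight S ∧ ∃ a : S → D → D, IsEmbeddingRightAction a := fun h => by
    obtain ⟨D, hD, h⟩ := h.exists_selfMap
    exact ⟨D, hD, exists_isEmbeddingRightAction h⟩
  have ofSelfMap : (∃ D : Type u, TopMonoidEmbeds Sᵐᵒᵖ (SelfMap D)) → IsLeftNA S := by
    rintro ⟨D, h⟩
    obtain ⟨a, ha⟩ := exists_isEmbeddingRightAction h
    exact ha.isLeftNA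
  have ofContEnd : (∃ (Y : Type u) (_ : TopologicalSpace Y),
      IsStoneSpace Y ∧ TopMonoidEmbeds S (ContEnd Y)) → IsLeftNA S := by
    rintro ⟨Y, _, hY, h⟩
    exact ofSelfMap (h.exists_selfMap_of_contEnd hY)
  have ofRing : (∃ (B : Type u) (_ : BooleanRing B), TopMonoidEmbeds Sᵐᵒᵖ (RingEndo B)) →
      IsLeftNA S := by
    rintro ⟨B, _, h⟩
    exact ofSelfMap ⟨B, h.selfMap_of_ringEndo⟩
  have ofNonexp : (∃ (M : Type u) (_ : MetricSpace M),
      IsUltrametricDist M ∧ TopMonoidEmbeds Sᵐᵒᵖ (Nonexp M)) → IsLeftNA S := by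
    rintro ⟨M, _, _, h⟩
    exact ofSelfMap h.exists_selfMap_of_nonexp
  have ofUltra : HasRightNonexpansiveUltraUniformity S → IsLeftNA S := fun h => by
    have : T2Space S := by
      obtain ⟨U, hU, hT, -⟩ := h
      rwa [hU] at hT
    exact ofSelfMap h.exists_selfMap
  have ofUnif : (∃ (Y : Type u) (_ : UniformSpace Y),
      T2Space Y ∧ IsUltraUniformity Y ∧ TopMonoidEmbeds S (UnifEnd Y)) → IsLeftNA S := by
    rintro ⟨Y, _, _, _, h⟩
    exact ofSelfMap h.exists_selfMap_of_unifEnd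
  have ofCompact : (∃ (K : Type u) (_ : CommGroup K) (_ : TopologicalSpace K),
      IsCompactGroup K ∧ TopMonoidEmbeds S (GroupEnd K)) → IsLeftNA S := by
    rintro ⟨K, _, _, hK, h⟩
    have := hK.topologicalGroup
    have := hK.compact
    have := hK.t2
    exact ofSelfMap (h.exists_selfMap_of_groupEnd fun x hx =>
      exists_pontryaginDual_apply_ne_one hx)
  have toUltra : IsLeftNA S → HasRightNonexpansiveUltraUniformity S := fun h => by
    obtain ⟨D, -, a, ha⟩ := toSelfMap h
    exact ha.hasRightNonexpansiveUltraUniformity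
  have toUnif : IsLeftNA S → ∃ (Y : Type u) (_ : UniformSpace Y),
      T2Space Y ∧ IsUltraUniformity Y ∧ TopMonoidEmbeds S (UnifEnd Y) := fun h => by
    obtain ⟨D, -, a, ha⟩ := toSelfMap h
    exact ⟨D × D → Bool, inferInstance, inferInstance, inferInstance, ha.embeds_unifEnd_cube⟩
  have toContEnd : IsLeftNA S → ∃ (Y : Type u) (_ : TopologicalSpace Y),
      IsStoneSpace Y ∧ weight Y = weight S ∧ TopMonoidEmbeds S (ContEnd Y) := fun h => by
    obtain ⟨D, hD, a, ha⟩ := toSelfMap h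
    exact exists_stoneSpace_weight_eq hD ha
  have toRing : IsLeftNA S → ∃ (B : Type u) (_ : BooleanRing B),
      Cardinal.mk B ≤ max Cardinal.aleph0 (weight S) ∧
        TopMonoidEmbeds Sᵐᵒᵖ (RingEndo B) := fun h => by
    obtain ⟨D, hD, a, ha⟩ := toSelfMap h
    exact ⟨FreeBooleanRing D, inferInstance,
      (FreeBooleanRing.mk_le D).trans (max_le_max le_rfl hD), ha.embeds_ringEndo⟩
  have toNonexp : IsLeftNA S → ∃ (M : Type u) (_ : MetricSpace M),
      IsUltrametricDist M ∧ weight M ≤ weight S ∧ TopMonoidEmbeds Sᵐᵒᵖ (Nonexp M) := fun h => by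
    obtain ⟨D, hD, a, ha⟩ := toSelfMap h
    exact ⟨D, discreteMetricSpace D, isUltrametricDist_discreteMetricSpace D,
      (weight_discreteMetricSpace_le D).trans hD, ha.embeds_nonexp⟩
  have toBooleanGroup : IsLeftNA S →
      ∃ (K : Type u) (_ : Group K) (_ : TopologicalSpace K), IsProfiniteBooleanGroup K ∧
        weight K ≤ max Cardinal.aleph0 (weight S) ∧ TopMonoidEmbeds S (GroupEnd K) := fun h => by
    obtain ⟨D, hD, a, ha⟩ := toSelfMap h
    exact ⟨D × D → Multiplicative (ZMod 2), inferInstance, inferInstance,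
      isProfiniteBooleanGroup_cube _,
      (weight_square_cube_le D _).trans (max_le_max le_rfl hD), ha.embeds_groupEnd_cube⟩
  constructor
  · tfae_have 1 → 2 := toContEnd
    tfae_have 2 → 1 := fun ⟨Y, _, hY, _, h⟩ => ofContEnd ⟨Y, _, hY, h⟩
    tfae_have 1 → 3 := toRing
    tfae_have 3 → 1 := fun ⟨B, _, _, h⟩ => ofRing ⟨B, _, h⟩
    tfae_have 1 → 4 := IsLeftNA.exists_selfMap
    tfae_have 4 → 1 := fun ⟨D, _, h⟩ => ofSelfMap ⟨D, h⟩
    tfae_have 1 → 5 := toNonexp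
    tfae_have 5 → 1 := fun ⟨M, _, hM, _, h⟩ => ofNonexp ⟨M, _, hM, h⟩
    tfae_have 1 → 6 := toUltra
    tfae_have 6 → 1 := ofUltra
    tfae_have 1 → 7 := toUnif
    tfae_have 7 → 1 := ofUnif
    tfae_have 1 → 8 := toBooleanGroup
    tfae_have 8 → 9 := fun ⟨K, _, _, hK, hw, h⟩ =>
      ⟨K, { mul_comm := hK.mul_comm }, _, hK.compactGroup, hw, h⟩
    tfae_have 9 → 1 := fun ⟨K, _, _, hK, _, h⟩ => ofCompact ⟨K, _, _, hK, h⟩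
    tfae_finish
  · tfae_have 1 → 2 := fun h =>
      let ⟨Y, t, hY, _, h⟩ := toContEnd h
      ⟨Y, t, hY, h⟩
    tfae_have 2 → 1 := ofContEnd
    tfae_have 1 → 3 := fun h =>
      let ⟨B, i, _, h⟩ := toRing h
      ⟨B, i, h⟩
    tfae_have 3 → 1 := ofRing
    tfae_have 1 → 4 := fun h =>
      let ⟨D, _, h⟩ := IsLeftNA.exists_selfMap h
      ⟨D, h⟩
    tfae_have 4 → 1 := ofSelfMap
    tfae_have 1 → 5 := fun h =>
      let ⟨M, i, hM, _, h⟩ := toNonexp h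
      ⟨M, i, hM, h⟩
    tfae_have 5 → 1 := ofNonexp
    tfae_have 1 → 6 := toUltra
    tfae_have 6 → 1 := ofUltra
    tfae_have 1 → 7 := toUnif
    tfae_have 7 → 1 := ofUnif
    tfae_have 1 → 8 := fun h =>
      let ⟨K, i, t, hK, _, h⟩ := toBooleanGroup h
      ⟨K, i, t, hK, h⟩
    tfae_have 8 → 9 := fun ⟨K, _, _, hK, h⟩ =>
      ⟨K, { mul_comm := hK.mul_comm }, _, hK.compactGroup, h⟩
    tfae_have 9 → 1 := ofCompact
    tfae_finish
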